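/- Let $m$ be normalised Lebesgue measure on the unit circle $\mathbb T$. For $1\le q\le\infty$ let $(L^q)^n$, respectively $(H^q)^n$, be the space of column vectors of length $n$ with entries in $L^q=L^q(\mathbb T,m)$, respectively in the Hardy space $H^q=\{f\in L^q:\hat f(k)=0 \text{ for all } k<0\}$. Put $f(0)=\hat f(0)$ and $(\overline{H^q_0})^n=\{\overline f: f\in (H^q)^n,\ f(0)=0\}$. For $1<q<\infty$ let $P_{q+}$ be the Riesz projection of $(L^q)^n$ onto $(H^q)^n$ along $(\overline{H^q_0})^n$, and let $P_{q-}=I-P_{q+}$. Let $L^{(p,n\times n)}$ be the space of $n\times n$ matrix functions with entries in $L^p$. Let $\Theta$ be an $n\times n$ inner function, that is, a matrix function with entries in $H^\infty$ such that $\Theta(z)$ is unitary for almost every $z\in\mathbb T$. Put $$K_\Theta^q=\Theta(\overline{H^q_0})^n\cap (H^q)^n,\qquad P_{\Theta,q}=P_{q+}\,\Theta\,P_{q-}\,\Theta^*,$$ and let $P_\Theta$ be the orthogonal projection of $(L^2)^n$ onto $K_\Theta^2$. Let $p\in(2,\infty]$, let $q$ be given by $\frac12+\frac1p=\frac1q$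 (so $1<q\le 2$), and let $G\in L^{(p,n\times n)}$. The modified matrix-valued truncated Toeplitz operator is $$\tilde A_G^\Theta f=P_{\Theta,q}(Gf),\qquad f\in K_\Theta^2 .$$ Suppose that the map $f\mapsto P_\Theta(Gf)$ on $K_\Theta^2\cap (H^\infty)^n$ extends to a bounded operator $A_G^\Theta:K_\Theta^2\to K_\Theta^2$ (that is, $A_G^\Theta$ is a matrix-valued truncated Toeplitz operator). Then $(L^q)^n=(H^q)^n\oplus(\overline{H^q_0})^n$, so that $P_{q+}$ is well defined; $\tilde A_G^\Theta$ is a bounded linear operator from $K_\Theta^2$ into $K_\Theta^q$; and $$\tilde A_G^\Theta f=A_G^\Theta f\qquad\text{for all } f\in K_\Theta^2 .$$ In particular the image of $\tilde A_G^\Theta$ is contained in $K_\Theta^2$. -/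

import Mathlib

open MeasureTheory
open scoped ENNReal

noncomputable section

namespace MTTO

/-- Normalised Lebesgue measure on the unit circle. The circle is modelled as `ℝ / ℤ`, through
`t ↦ exp (2 π i t)`. -/
abbrev circleMeasure : Measure UnitAddCircle := AddCircle.haarAddCircle

/-- `(L^p)^n`: classes of `ℂⁿ`-valued functions on the unit circle whose entries lie in `L^p`.
For `p = 2` this carries the inner product `∑ i, ⟪f i, g i⟫`. -/
abbrev VecLp (n : ℕ) (p : ℝ≥0∞) := Lp (EuclideanSpace ℂ (Fin n)) p circleMeasure

/-- `M ∈ L^{(p, n × n)}`: every entry of the matrix function `M` lies in `L^p`. -/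
def MemMatLp {n : ℕ} (p : ℝ≥0∞) (M : UnitAddCircle → Matrix (Fin n) (Fin n) ℂ) : Prop :=
  ∀ i j, MemLp (fun t => M t i j) p circleMeasure

lemma MemMatLp.conjTranspose {n : ℕ} {p : ℝ≥0∞} {M : UnitAddCircle → Matrix (Fin n) (Fin n) ℂ}
    (hM : MemMatLp p M) : MemMatLp p (fun t => (M t).conjTranspose) :=
  fun i j => (hM j i).star

lemma MemMatLp.mono {n : ℕ} {p q : ℝ≥0∞} {M : UnitAddCircle → Matrix (Fin n) (Fin n) ℂ}
    (hM : MemMatLp p M) (hqp : q ≤ p) : MemMatLp q M :=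
  fun i j => (hM i j).mono_exponent hqp

lemma MemMatLp.memLp_mulVec {n : ℕ} {p r q : ℝ≥0∞} [ENNReal.HolderTriple p r q]
    {M : UnitAddCircle → Matrix (Fin n) (Fin n) ℂ} (hM : MemMatLp p M) (f : VecLp n r) :
    MemLp (fun t => WithLp.toLp 2 ((M t).mulVec (f t).ofLp) :
      UnitAddCircle → EuclideanSpace ℂ (Fin n)) q circleMeasure := by
  refine MemLp.of_eval_piLp fun i => ?_
  have h : ∀ j ∈ (Finset.univ : Finset (Fin n)),
      MemLp (fun t => M t i j * f t j) q circleMeasure := fun j _ =>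
    ((Lp.memLp f).eval_piLp j).mul' (hM i j)
  simpa [Matrix.mulVec, dotProduct] using memLp_finsetSum _ h

/-- Multiplication by a matrix function with entries in `L^p`, as a map
`(L^r)^n → (L^q)^n` where `1 / p + 1 / r = 1 / q`. -/
def mulLp {n : ℕ} {p r q : ℝ≥0∞} [ENNReal.HolderTriple p r q]
    (M : UnitAddCircle → Matrix (Fin n) (Fin n) ℂ) (hM : MemMatLp p M) :
    VecLp n r →ₗ[ℂ] VecLp n q where
  toFun f := (hM.memLp_mulVec f).toLp
  map_add' f g := by
    rw [← MemLp.toLp_add, MemLp.toLp_eq_toLp_iff]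
    filter_upwards [Lp.coeFn_add f g] with t ht
    rw [ht]
    simp [Matrix.mulVec_add]
  map_smul' c f := by
    rw [RingHom.id_apply, ← MemLp.toLp_const_smul, MemLp.toLp_eq_toLp_iff]
    filter_upwards [Lp.coeFn_smul c f] with t ht
    simp [ht, Matrix.mulVec_smul]

lemma VecLp.integrable {n : ℕ} {p : ℝ≥0∞} [hp : Fact (1 ≤ p)] (f : VecLp n p) :
    Integrable f circleMeasure :=
  (Lp.memLp f).integrable hp.out

lemma fourierCoeff_add' {n : ℕ} {p : ℝ≥0∞} [Fact (1 ≤ p)] (f g : VecLp n p) (k : ℤ) :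
    fourierCoeff (f + g : VecLp n p) k = fourierCoeff f k + fourierCoeff g k := by
  rw [fourierCoeff_congr_ae (Lp.coeFn_add f g),
    fourierCoeff.add (VecLp.integrable f) (VecLp.integrable g), Pi.add_apply]

lemma fourierCoeff_smul' {n : ℕ} {p : ℝ≥0∞} [Fact (1 ≤ p)] (c : ℂ) (f : VecLp n p) (k : ℤ) :
    fourierCoeff (c • f : VecLp n p) k = c • fourierCoeff f k := by
  rw [fourierCoeff_congr_ae (Lp.coeFn_smul c f), fourierCoeff.const_smul]

lemma fourierCoeff_zero' {n : ℕ} {p : ℝ≥0∞} [Fact (1 ≤ p)] (k : ℤ) :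
    fourierCoeff (0 : VecLp n p) k = 0 := by
  simpa using fourierCoeff_smul' (0 : ℂ) (0 : VecLp n p) k

/-- The Hardy space `(H^p)^n`, `1 ≤ p ≤ ∞`, as a subspace of `(L^p)^n`: the functions whose
negative Fourier coefficients vanish. -/
def hardy (n : ℕ) (p : ℝ≥0∞) [Fact (1 ≤ p)] : Submodule ℂ (VecLp n p) where
  carrier := {f | ∀ k : ℤ, k < 0 → fourierCoeff f k = 0}
  add_mem' hf hg k hk := by rw [fourierCoeff_add', hf k hk, hg k hk, add_zero]
  zero_mem' k _ := fourierCoeff_zero' k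
  smul_mem' c f hf k hk := by rw [fourierCoeff_smul', hf k hk, smul_zero]

/-- The space of complex conjugates of the functions `f ∈ (H^p)^n` with `f(0) = 0`, where
`f(0)` is the Fourier coefficient of `f` of index `0`: the functions whose nonnegative Fourier
coefficients vanish (see `mem_conjHardyZero_iff`). -/
def conjHardyZero (n : ℕ) (p : ℝ≥0∞) [Fact (1 ≤ p)] : Submodule ℂ (VecLp n p) where
  carrier := {f | ∀ k : ℤ, 0 ≤ k → fourierCoeff f k = 0}
  add_mem' hf hg k hk := by rw [fourierCoeff_add', hf k hk, hg k hk, add_zero]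
  zero_mem' k _ := fourierCoeff_zero' k
  smul_mem' c f hf k hk := by rw [fourierCoeff_smul', hf k hk, smul_zero]

/-- Entrywise complex conjugation on `ℂⁿ`. -/
def conjVec {n : ℕ} (v : EuclideanSpace ℂ (Fin n)) : EuclideanSpace ℂ (Fin n) :=
  WithLp.toLp 2 (fun i => star (v i))

lemma fourierCoeff_conj {n : ℕ} {p : ℝ≥0∞} [Fact (1 ≤ p)] (f : VecLp n p) (k : ℤ) :
    fourierCoeff (fun t => conjVec (f t)) k = conjVec (fourierCoeff f (-k)) := by
  have hf : Integrable (fun t => fourier k t • f t) circleMeasure := by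
    simpa using (VecLp.integrable f).fourier_smul k
  have hfc : Integrable (fun t => fourier (-k) t • conjVec (f t)) circleMeasure := by
    refine Integrable.of_eval_piLp fun i => ?_
    have h := (memLp_one_iff_integrable.2 (hf.eval_piLp i)).star
    refine (memLp_one_iff_integrable.1 h).congr (Filter.Eventually.of_forall fun t => ?_)
    simp [conjVec]
  ext i
  simp only [fourierCoeff, neg_neg]
  rw [eval_integral_piLp (fun j => hfc.eval_piLp j)]
  simp only [conjVec]
  rw [eval_integral_piLp (fun j => hf.eval_piLp j)]
  rw [← starRingEnd_apply, ← integral_conj]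
  refine integral_congr_ae (Filter.Eventually.of_forall fun t => ?_)
  simp

lemma mem_conjHardyZero_iff {n : ℕ} {p : ℝ≥0∞} [Fact (1 ≤ p)] (f : VecLp n p) :
    f ∈ conjHardyZero n p ↔ ∃ g ∈ hardy n p, fourierCoeff g 0 = 0 ∧
      f =ᵐ[circleMeasure] fun t => conjVec (g t) := by
  have hzero : conjVec (0 : EuclideanSpace ℂ (Fin n)) = 0 := by ext i; simp [conjVec]
  constructor
  · intro hf
    have hg : MemLp (fun t => conjVec (f t)) p circleMeasure :=
      MemLp.of_eval_piLp fun i => ((Lp.memLp f).eval_piLp i).star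
    have key : ∀ k : ℤ, k ≤ 0 → fourierCoeff (hg.toLp : VecLp n p) k = 0 := fun k hk => by
      rw [fourierCoeff_congr_ae hg.coeFn_toLp, fourierCoeff_conj, hf (-k) (by omega), hzero]
    refine ⟨hg.toLp, fun k hk => key k hk.le, key 0 le_rfl, ?_⟩
    filter_upwards [hg.coeFn_toLp] with t ht
    rw [ht]
    ext i
    simp [conjVec]
  · rintro ⟨g, hg, hg0, hfg⟩ k hk
    rw [fourierCoeff_congr_ae hfg, fourierCoeff_conj]
    rcases hk.eq_or_lt with rfl | hk
    · rw [neg_zero, hg0, hzero]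
    · rw [hg (-k) (by omega), hzero]

/-- The Riesz projection `P_{q+}` of `(L^q)^n` onto `(H^q)^n` along the conjugates of the functions
in `(H^q)^n` that vanish at `0`. For `1 < q < ∞` the two spaces are complementary (a theorem of
M. Riesz); where they are not, the value is `0`. -/
def rieszPlus (n : ℕ) (q : ℝ≥0∞) [Fact (1 ≤ q)] : VecLp n q →ₗ[ℂ] VecLp n q :=
  open Classical in
  if h : IsCompl (hardy n q) (conjHardyZero n q) then
    (hardy n q).projection (conjHardyZero n q) h
  else 0

/-- The complementary projection `P_{q-} = I - P_{q+}`. -/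
def rieszMinus (n : ℕ) (q : ℝ≥0∞) [Fact (1 ≤ q)] : VecLp n q →ₗ[ℂ] VecLp n q :=
  LinearMap.id - rieszPlus n q

/-- An `n`-by-`n` matrix inner function: an element of `H^{(∞, n × n)}` with unitary values almost
everywhere on the circle. -/
structure InnerMatrix (n : ℕ) where
  toFun : UnitAddCircle → Matrix (Fin n) (Fin n) ℂ
  memMatLp : MemMatLp ∞ toFun
  analytic : ∀ i j, ∀ k : ℤ, k < 0 → fourierCoeff (fun t => toFun t i j) k = 0
  unitary : ∀ᵐ t ∂circleMeasure, toFun t ∈ Matrix.unitaryGroup (Fin n) ℂ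

/-- Multiplication by `Θ` on `(L^q)^n`. -/
def InnerMatrix.mul {n : ℕ} (Θ : InnerMatrix n) (q : ℝ≥0∞) : VecLp n q →ₗ[ℂ] VecLp n q :=
  mulLp Θ.toFun Θ.memMatLp

/-- Multiplication by `Θ*` on `(L^q)^n`. -/
def InnerMatrix.mulAdjoint {n : ℕ} (Θ : InnerMatrix n) (q : ℝ≥0∞) : VecLp n q →ₗ[ℂ] VecLp n q :=
  mulLp (fun t => (Θ.toFun t).conjTranspose) Θ.memMatLp.conjTranspose

/-- The model space `K_Θ^q`: the intersection of `(H^q)^n` with the image under `Θ` of the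
conjugates of the functions in `(H^q)^n` that vanish at `0`. -/
def modelSpace {n : ℕ} (Θ : InnerMatrix n) (q : ℝ≥0∞) [Fact (1 ≤ q)] :
    Submodule ℂ (VecLp n q) :=
  (conjHardyZero n q).map (Θ.mul q) ⊓ hardy n q

lemma InnerMatrix.norm_mul {n : ℕ} (Θ : InnerMatrix n) (f : VecLp n 2) :
    ‖Θ.mul 2 f‖ = ‖f‖ := by
  change ‖(Θ.memMatLp.memLp_mulVec f).toLp‖ = ‖f‖
  rw [Lp.norm_toLp, Lp.norm_def]
  congr 1
  refine eLpNorm_congr_norm_ae ?_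
  filter_upwards [Θ.unitary] with t ht
  rw [Matrix.mem_unitaryGroup_iff', Matrix.star_eq_conjTranspose] at ht
  rw [@norm_eq_sqrt_re_inner ℂ, @norm_eq_sqrt_re_inner ℂ _ _ _ _ (f t),
    EuclideanSpace.inner_eq_star_dotProduct, EuclideanSpace.inner_eq_star_dotProduct,
    Matrix.star_mulVec, dotProduct_comm, Matrix.dotProduct_mulVec, Matrix.vecMul_vecMul, ht,
    Matrix.vecMul_one, dotProduct_comm]

lemma continuous_fourierCoeff {n : ℕ} {p : ℝ≥0∞} [hp : Fact (1 ≤ p)] (k : ℤ) :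
    Continuous fun f : VecLp n p => fourierCoeff f k := by
  let L : VecLp n p →ₗ[ℂ] EuclideanSpace ℂ (Fin n) :=
    { toFun := fun f => fourierCoeff f k
      map_add' := fun f g => fourierCoeff_add' f g k
      map_smul' := fun c f => fourierCoeff_smul' c f k }
  refine (L.mkContinuous 1 fun f => ?_).continuous
  have h1 : ‖fourierCoeff f k‖ ≤ ∫ t, ‖f t‖ ∂circleMeasure := by
    refine (norm_integral_le_integral_norm _).trans (le_of_eq ?_)
    refine integral_congr_ae (Filter.Eventually.of_forall fun t => ?_)
    beta_reduce
    rw [norm_smul, fourier_apply, Circle.norm_coe, one_mul]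
  have h2 : ∫ t, ‖f t‖ ∂circleMeasure = (eLpNorm f 1 circleMeasure).toReal := by
    rw [integral_norm_eq_lintegral_enorm (Lp.aestronglyMeasurable f), eLpNorm_one_eq_lintegral_enorm]
  rw [one_mul, Lp.norm_def]
  exact (h1.trans h2.le).trans (ENNReal.toReal_mono (Lp.eLpNorm_ne_top f)
    (eLpNorm_le_eLpNorm_of_exponent_le hp.out (Lp.aestronglyMeasurable f)))

lemma isClosed_hardy {n : ℕ} {p : ℝ≥0∞} [Fact (1 ≤ p)] : IsClosed (hardy n p : Set (VecLp n p)) := by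
  have h : (hardy n p : Set (VecLp n p)) = ⋂ k : ℤ, ⋂ _ : k < 0, {f : VecLp n p | fourierCoeff f k = 0} := by
    ext f; simp [hardy]
  rw [h]
  exact isClosed_iInter fun k => isClosed_iInter fun _ =>
    isClosed_eq (continuous_fourierCoeff k) continuous_const

lemma isClosed_conjHardyZero {n : ℕ} {p : ℝ≥0∞} [Fact (1 ≤ p)] :
    IsClosed (conjHardyZero n p : Set (VecLp n p)) := by
  have h : (conjHardyZero n p : Set (VecLp n p)) =
      ⋂ k : ℤ, ⋂ _ : 0 ≤ k, {f : VecLp n p | fourierCoeff f k = 0} := by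
    ext f; simp [conjHardyZero]
  rw [h]
  exact isClosed_iInter fun k => isClosed_iInter fun _ =>
    isClosed_eq (continuous_fourierCoeff k) continuous_const

/-- The model space `K_Θ = K_Θ^2` is closed in `(L²)^n`, so that the orthogonal projection onto it
exists. -/
instance modelSpace.hasOrthogonalProjection {n : ℕ} (Θ : InnerMatrix n) :
    (modelSpace Θ 2).HasOrthogonalProjection := by
  let U : VecLp n 2 →ₗᵢ[ℂ] VecLp n 2 := ⟨Θ.mul 2, Θ.norm_mul⟩
  have h : IsClosed (modelSpace Θ 2 : Set (VecLp n 2)) :=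
    (U.isometry.isClosedEmbedding.isClosedMap _ isClosed_conjHardyZero).inter isClosed_hardy
  have : CompleteSpace (modelSpace Θ 2) := h.isComplete.completeSpace_coe
  infer_instance

/-- `A_G^Θ` is a matrix-valued truncated Toeplitz operator with symbol `G ∈ L^{(2, n × n)}`: the
bounded operator `A` on `K_Θ` extends the map `f ↦ P_Θ (G f)` from `K_Θ ∩ (H^∞)^n`, where `P_Θ` is the
orthogonal projection of `(L²)^n` onto `K_Θ`. An element of `K_Θ ∩ (H^∞)^n` is given as a
class `f ∈ K_Θ` that agrees almost everywhere with a class `g ∈ (H^∞)^n`. -/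
def IsMTTO {n : ℕ} (Θ : InnerMatrix n) (G : UnitAddCircle → Matrix (Fin n) (Fin n) ℂ)
    (hG : MemMatLp 2 G) (A : modelSpace Θ 2 →L[ℂ] modelSpace Θ 2) : Prop :=
  ∀ (f : modelSpace Θ 2) (g : hardy n ∞), f.1 =ᵐ[circleMeasure] g.1 →
    A f = (modelSpace Θ 2).orthogonalProjectionOnto (mulLp (p := 2) (r := ∞) (q := 2) G hG g.1)

/-- The projection `P_{Θ,q} = P_{q+} Θ P_{q-} Θ*` of `(L^q)^n`. -/
def modelProj {n : ℕ} (Θ : InnerMatrix n) (q : ℝ≥0∞) [Fact (1 ≤ q)] :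
    VecLp n q →ₗ[ℂ] VecLp n q :=
  rieszPlus n q ∘ₗ Θ.mul q ∘ₗ rieszMinus n q ∘ₗ Θ.mulAdjoint q

/-- The modified matrix-valued truncated Toeplitz operator `f ↦ P_{Θ,q} (G f)` on `K_Θ^2`, where
`G ∈ L^{(p, n × n)}` and `1 / p + 1 / 2 = 1 / q`. -/
def modifiedMTTO {n : ℕ} (Θ : InnerMatrix n) {p q : ℝ≥0∞} [ENNReal.HolderTriple p 2 q]
    [Fact (1 ≤ q)] (G : UnitAddCircle → Matrix (Fin n) (Fin n) ℂ) (hG : MemMatLp p G) :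
    modelSpace Θ 2 →ₗ[ℂ] VecLp n q :=
  modelProj Θ q ∘ₗ mulLp G hG ∘ₗ (modelSpace Θ 2).subtype

end MTTO

end

/-! Both operators are continuous from $K_\Theta^2$ to $L^q$, so it suffices to compare them on a
dense set of bounded functions. If $f$ is bounded, then $Gf\in L^2$. On $L^2$ the projection
$P_{\Theta,q}$ restricts to $P_{\Theta,2}$, because the inclusion $L^2\to L^q$ keeps Fourier
coefficients and hence the Riesz decomposition (`modelProj_lpIncl`); and $P_{\Theta,2}$ is the
orthogonal projection onto the model space (`modelProj_two`). So the two operators agree on such $f$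
by the definition of a truncated Toeplitz operator (`modifiedMTTO_eq_of_bounded`).

Bounded functions are dense because $P_\Theta$ sends vector characters to bounded functions: for
$e=z^kv$ with $k\ge0$, $P_\Theta e=e-\Theta P_+\Theta^*e$, and $P_+\Theta^*e$ is a polynomial of
degree at most $k$ (`exists_lpIncl_eq_modelProj_trigVec`); for $k<0$ the projection is $0$.

The analytic input is M. Riesz's theorem for $1<q\le2$ (`isCompl_hardy`). It rests on a pointwise
inequality in the right half plane (`exists_norm_rpow_le`), integrated against the mean value
property of $F^q$ for an analytic polynomial $F$ with positive real part. Positive real parts of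
polynomials approximate nonnegative continuous functions, four of which make up any continuous
function, and these are dense in $L^q$. Boundedness of all the projections then follows from the
closed graph theorem. -/

noncomputable section

namespace MTTO

/-! ### Complex analysis behind M. Riesz's inequality -/

/-- For `1 < q ≤ 2`, the function `‖z‖ ^ q` on the right half plane is dominated by a multiple of
`(re z) ^ q` up to the real part of the holomorphic function `- D z ^ q`. -/
lemma exists_norm_rpow_le {q : ℝ} (h1 : 1 < q) (h2 : q ≤ 2) :
    ∃ C D : ℝ, 0 ≤ C ∧ 0 ≤ D ∧ ∀ z : ℂ, 0 < z.re →
      ‖z‖ ^ q ≤ C * z.re ^ q - D * (z ^ (q : ℂ)).re := by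
  have hpi := Real.pi_pos
  have hq0 : 0 < q := by linarith
  -- The threshold angle: $aq$ is the midpoint of $\pi/2$ and $q\pi/2$, so that $a<\pi/2$ while
  -- $\cos(aq)<0$.
  set a : ℝ := (Real.pi / 4 * (1 + q)) / q with ha
  have haq : a * q = Real.pi / 4 * (1 + q) := by rw [ha]; field_simp
  have ha0 : 0 < a := by positivity
  have ha2 : a < Real.pi / 2 := by
    rw [ha, div_lt_iff₀ hq0]; nlinarith
  have hc : Real.cos (a * q) < 0 := by
    apply Real.cos_neg_of_pi_div_two_lt_of_lt
    · rw [haq]; nlinarith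
    · rw [haq]; nlinarith
  have hca : 0 < Real.cos a := Real.cos_pos_of_mem_Ioo ⟨by linarith, ha2⟩
  set D : ℝ := (-Real.cos (a * q))⁻¹ with hD
  have hD0 : 0 < D := inv_pos.2 (by linarith)
  have hDc : D * -Real.cos (a * q) = 1 := inv_mul_cancel₀ (by linarith)
  refine ⟨(1 + D) / Real.cos a ^ q, D, by positivity, hD0.le, fun z hz => ?_⟩
  have hz0 : z ≠ 0 := by rintro rfl; simp at hz
  have hre : z.re = ‖z‖ * Real.cos |z.arg| := by
    rw [Real.cos_abs, Complex.norm_mul_cos_arg]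
  have harg : |z.arg| < Real.pi / 2 := Complex.abs_arg_lt_pi_div_two_iff.2 (Or.inl hz)
  have hcos : 0 < Real.cos |z.arg| :=
    Real.cos_pos_of_mem_Ioo ⟨by linarith [abs_nonneg z.arg], harg⟩
  have hcq : Real.cos (z.arg * q) = Real.cos (|z.arg| * q) := by
    rw [← Real.cos_abs, abs_mul, abs_of_pos hq0]
  rw [Complex.cpow_ofReal_re, hcq, hre, Real.mul_rpow (norm_nonneg _) hcos.le]
  have hb0 : 0 ≤ |z.arg| := abs_nonneg _
  generalize |z.arg| = b at *
  have hzq : 0 ≤ ‖z‖ ^ q := by positivity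
  suffices h : 1 ≤ (1 + D) / Real.cos a ^ q * Real.cos b ^ q - D * Real.cos (b * q) by
    nlinarith [mul_le_mul_of_nonneg_left h hzq]
  -- For arguments up to $a$ the term in $\cos^q b$ alone gives at least $1+D$. Beyond $a$, $D$ is
  -- normalised so that $-D\cos(bq)\ge-D\cos(aq)=1$; here $q\le2$ keeps $bq$ in $[0,\pi]$, where
  -- cosine decreases.
  rcases le_total b a with hba | hba
  · have : Real.cos a ^ q ≤ Real.cos b ^ q := by
      apply Real.rpow_le_rpow hca.le _ hq0.le
      exact Real.cos_le_cos_of_nonneg_of_le_pi hb0 (by linarith) hba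
    have h3 : 1 + D ≤ (1 + D) / Real.cos a ^ q * Real.cos b ^ q := by
      rw [div_mul_eq_mul_div, le_div_iff₀ (by positivity)]
      exact mul_le_mul_of_nonneg_left this (by positivity)
    nlinarith [Real.cos_le_one (b * q)]
  · have h3 : Real.cos (b * q) ≤ Real.cos (a * q) :=
      Real.cos_le_cos_of_nonneg_of_le_pi (by positivity) (by nlinarith)
        (mul_le_mul_of_nonneg_right hba hq0.le)
    have h4 : 0 ≤ (1 + D) / Real.cos a ^ q * Real.cos b ^ q := by positivity
    nlinarith

/-- A function that is holomorphic on the plane and has positive real part on the unit circle has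
positive real part on the closed unit disc. -/
lemma re_pos_of_re_pos_on_sphere {F : ℂ → ℂ} (hF : Differentiable ℂ F)
    (h : ∀ z ∈ Metric.sphere (0 : ℂ) 1, 0 < (F z).re) :
    ∀ z ∈ Metric.closedBall (0 : ℂ) 1, 0 < (F z).re := by
  obtain ⟨w, hw, hmin⟩ := (isCompact_sphere (0 : ℂ) 1).exists_isMinOn
    ⟨1, by simp⟩ (Complex.continuous_re.comp hF.continuous).continuousOn
  intro z hz
  -- Since $|e^{-F}|=e^{-\operatorname{Re}F}$, the maximum modulus principle for $e^{-F}$ is a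
  -- minimum principle for $\operatorname{Re}F$.
  have hd : DiffContOnCl ℂ (fun z => Complex.exp (-F z)) (Metric.ball 0 1) :=
    (Complex.differentiable_exp.comp hF.neg).diffContOnCl
  have := Complex.norm_le_of_forall_mem_frontier_norm_le Metric.isBounded_ball hd
    (C := Real.exp (-(F w).re)) (fun y hy => by
      rw [frontier_ball _ one_ne_zero] at hy
      rw [Complex.norm_exp, Real.exp_le_exp, Complex.neg_re, neg_le_neg_iff]
      exact hmin hy) (by rwa [closure_ball _ one_ne_zero])
  rw [Complex.norm_exp, Real.exp_le_exp, Complex.neg_re, neg_le_neg_iff] at this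
  exact (h w hw).trans_le this

/-- The mean value property for integrals over the additive circle. -/
lemma integral_comp_toCircle {F : ℂ → ℂ} (hF : DiffContOnCl ℂ F (Metric.ball 0 1)) :
    ∫ t, F (fourier 1 t) ∂circleMeasure = F 0 := by
  have hm := DiffContOnCl.circleAverage (R := 1) (c := 0) (by simpa using hF)
  rw [← hm, Real.circleAverage_def]
  change ∫ t : AddCircle (1 : ℝ), F (fourier 1 t) ∂AddCircle.haarAddCircle = _
  rw [AddCircle.integral_haarAddCircle, ← AddCircle.intervalIntegral_preimage 1 0]
  have h2 := intervalIntegral.integral_comp_mul_left (E := ℂ) (a := 0) (b := 1)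
    (fun θ => F (circleMap 0 1 θ)) (c := 2 * Real.pi) (by positivity)
  simp only [mul_zero, mul_one] at h2
  rw [← h2]
  simp only [inv_one, one_smul, zero_add]
  refine intervalIntegral.integral_congr fun x _ => ?_
  have hx : (fourier 1 : C(UnitAddCircle, ℂ)) (x : UnitAddCircle)
      = circleMap 0 1 (2 * Real.pi * x) := by
    rw [fourier_coe_apply]
    simp [circleMap, mul_comm, mul_left_comm]
  exact congrArg F hx

/-- The pointwise inequality is integrated over the circle. As $F$ stays in the right half plane on
the closed disc, $F^q$ is holomorphic inside and has mean $F(0)^q$; since $F(0)$ is a positive real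
number, the term with $-D$ can be dropped. -/
lemma integral_norm_rpow_le {q : ℝ} {C D : ℝ} (hD : 0 ≤ D)
    (h : ∀ z : ℂ, 0 < z.re → ‖z‖ ^ q ≤ C * z.re ^ q - D * (z ^ (q : ℂ)).re)
    {F : ℂ → ℂ} (hF : Differentiable ℂ F) (hpos : ∀ z ∈ Metric.sphere (0 : ℂ) 1, 0 < (F z).re)
    (h0 : (F 0).im = 0) :
    ∫ t, ‖F (fourier 1 t)‖ ^ q ∂circleMeasure ≤
      C * ∫ t, (F (fourier 1 t)).re ^ q ∂circleMeasure := by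
  have hpos' := re_pos_of_re_pos_on_sphere hF hpos
  have hs : ∀ t : UnitAddCircle, 0 < (F (fourier 1 t)).re := fun t => by
    apply hpos; rw [mem_sphere_zero_iff_norm, fourier_apply, Circle.norm_coe]
  have hne : ∀ t : UnitAddCircle, F (fourier 1 t) ≠ 0 := fun t h => by
    have := hs t; rw [h] at this; exact lt_irrefl _ this
  have hFc : Continuous fun t : UnitAddCircle => F (fourier 1 t) :=
    hF.continuous.comp (fourier 1).continuous
  have i1 : Integrable (fun t => ‖F (fourier 1 t)‖ ^ q) circleMeasure :=
    (hFc.norm.rpow_const fun t => Or.inl (norm_ne_zero_iff.2 (hne t))).integrable_of_hasCompactSupport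
      (HasCompactSupport.of_compactSpace _)
  have i2 : Integrable (fun t => (F (fourier 1 t)).re ^ q) circleMeasure :=
    ((Complex.continuous_re.comp hFc).rpow_const fun t => Or.inl (hs t).ne').integrable_of_hasCompactSupport
      (HasCompactSupport.of_compactSpace _)
  have c3 : Continuous (fun t : UnitAddCircle => F (fourier 1 t) ^ (q : ℂ)) :=
    hFc.cpow continuous_const fun t => Or.inl (hs t)
  have i3 : Integrable (fun t => F (fourier 1 t) ^ (q : ℂ)) circleMeasure :=
    c3.integrable_of_hasCompactSupport (HasCompactSupport.of_compactSpace _)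
  have hmv := integral_comp_toCircle (F := fun z => F z ^ (q : ℂ))
    (DifferentiableOn.diffContOnCl (by
    rw [closure_ball _ one_ne_zero]
    exact hF.differentiableOn.cpow_const fun z hz => Or.inl (hpos' z hz)))
  have hF0 : 0 ≤ (F 0 ^ (q : ℂ)).re := by
    have h1 : F 0 = ((F 0).re : ℂ) := by apply Complex.ext <;> simp [h0]
    have h2 := hpos' 0 (by simp)
    rw [h1, ← Complex.ofReal_cpow h2.le, Complex.ofReal_re]
    positivity
  calc ∫ t, ‖F (fourier 1 t)‖ ^ q ∂circleMeasure
      ≤ ∫ t, (C * (F (fourier 1 t)).re ^ q - D * RCLike.re (F (fourier 1 t) ^ (q : ℂ)))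
          ∂circleMeasure :=
        integral_mono i1 ((i2.const_mul C).sub (i3.re.const_mul D)) fun t => h _ (hs t)
    _ = C * ∫ t, (F (fourier 1 t)).re ^ q ∂circleMeasure - D * (F 0 ^ (q : ℂ)).re := by
        rw [integral_sub (i2.const_mul C) (i3.re.const_mul D), integral_const_mul,
          integral_const_mul]
        congr 2
        rw [← hmv]
        exact integral_re i3
    _ ≤ _ := by nlinarith

/-! ### The Riesz projection on continuous functions and trigonometric polynomials -/

/-- The inclusion of `L^p` into `L^q` on the circle, for `q ≤ p`. -/
def lpIncl (E : Type*) [NormedAddCommGroup E] [NormedSpace ℂ E] {p q : ℝ≥0∞} [Fact (1 ≤ p)]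
    [Fact (1 ≤ q)] (hqp : q ≤ p) : Lp E p circleMeasure →L[ℂ] Lp E q circleMeasure :=
  LinearMap.mkContinuous
    { toFun := fun f => ((Lp.memLp f).mono_exponent hqp).toLp
      map_add' := fun f g => by
        rw [← MemLp.toLp_add, MemLp.toLp_eq_toLp_iff]
        exact Lp.coeFn_add f g
      map_smul' := fun c f => by
        rw [RingHom.id_apply, ← MemLp.toLp_const_smul, MemLp.toLp_eq_toLp_iff]
        exact Lp.coeFn_smul c f } 1 fun f => by
    rw [one_mul]
    change ‖((Lp.memLp f).mono_exponent hqp).toLp‖ ≤ ‖f‖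
    rw [Lp.norm_toLp, Lp.norm_def]
    exact ENNReal.toReal_mono (Lp.eLpNorm_ne_top f)
      (eLpNorm_le_eLpNorm_of_exponent_le hqp (Lp.aestronglyMeasurable f))

lemma coeFn_lpIncl {E : Type*} [NormedAddCommGroup E] [NormedSpace ℂ E] {p q : ℝ≥0∞}
    [Fact (1 ≤ p)] [Fact (1 ≤ q)] (hqp : q ≤ p) (f : Lp E p circleMeasure) :
    lpIncl E hqp f =ᵐ[circleMeasure] f :=
  ((Lp.memLp f).mono_exponent hqp).coeFn_toLp

/-- The class in `L^p` of a continuous function on the circle. -/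
abbrev ctsLp (p : ℝ≥0∞) [Fact (1 ≤ p)] : C(UnitAddCircle, ℂ) →L[ℂ] Lp ℂ p circleMeasure :=
  ContinuousMap.toLp p circleMeasure ℂ

lemma lpIncl_ctsLp {p q : ℝ≥0∞} [Fact (1 ≤ p)] [Fact (1 ≤ q)] (hqp : q ≤ p)
    (f : C(UnitAddCircle, ℂ)) : lpIncl ℂ hqp (ctsLp p f) = ctsLp q f := by
  refine Lp.ext ((coeFn_lpIncl hqp _).trans ?_)
  exact (ContinuousMap.coeFn_toLp circleMeasure f).trans
    (ContinuousMap.coeFn_toLp circleMeasure f).symm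

/-- The scalar Hardy space `H²`, as the closed span of the characters of nonnegative index. -/
def hardyTwo : Submodule ℂ (Lp ℂ 2 circleMeasure) :=
  (Submodule.span ℂ (fourierLp 2 '' {k : ℤ | 0 ≤ k})).topologicalClosure

instance : CompleteSpace hardyTwo :=
  (Submodule.isClosed_topologicalClosure _).isComplete.completeSpace_coe

lemma starProjection_hardyTwo_fourierLp (k : ℤ) :
    hardyTwo.starProjection (fourierLp 2 k) = if 0 ≤ k then fourierLp 2 k else 0 := by
  split_ifs with hk
  · rw [Submodule.starProjection_eq_self_iff]
    exact Submodule.le_topologicalClosure _ (Submodule.subset_span ⟨k, hk, rfl⟩)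
  · rw [Submodule.starProjection_apply_eq_zero_iff, hardyTwo, Submodule.orthogonal_closure,
      Submodule.mem_orthogonal]
    intro u hu
    induction hu using Submodule.span_induction with
    | mem x h =>
      obtain ⟨j, hj, rfl⟩ := h
      exact orthonormal_fourier.inner_eq_zero (fun h => hk (h ▸ hj))
    | zero => simp
    | add x y _ _ hx hy => rw [inner_add_left, hx, hy, add_zero]
    | smul c x _ hx => rw [inner_smul_left, hx, mul_zero]

/-- The Riesz projection on continuous functions, with values in `L^q`, `q ≤ 2`. -/
def rieszCts {q : ℝ≥0∞} [Fact (1 ≤ q)] (hq : q ≤ 2) :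
    C(UnitAddCircle, ℂ) →L[ℂ] Lp ℂ q circleMeasure :=
  lpIncl ℂ hq ∘L hardyTwo.starProjection ∘L ctsLp 2

lemma rieszCts_fourier {q : ℝ≥0∞} [Fact (1 ≤ q)] (hq : q ≤ 2) (k : ℤ) :
    rieszCts hq (fourier k) = if 0 ≤ k then fourierLp q k else 0 := by
  change lpIncl ℂ hq (hardyTwo.starProjection (fourierLp 2 k)) = _
  rw [starProjection_hardyTwo_fourierLp]
  split_ifs
  · exact lpIncl_ctsLp hq _
  · simp

/-- The boundary values of an analytic polynomial. -/
def polyCts (Q : Polynomial ℂ) : C(UnitAddCircle, ℂ) := Polynomial.aeval (fourier 1) Q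

lemma polyCts_apply (Q : Polynomial ℂ) (t : UnitAddCircle) :
    polyCts Q t = Q.eval (fourier 1 t) := by
  rw [polyCts, Polynomial.aeval_continuousMap_apply]

lemma fourier_one_pow (k : ℕ) : (fourier 1 : C(UnitAddCircle, ℂ)) ^ k = fourier k := by
  induction k with
  | zero => ext; simp
  | succ k ih =>
    ext t
    rw [pow_succ, ih, Nat.cast_succ, fourier_add]
    rfl

lemma polyCts_monomial (k : ℕ) (c : ℂ) : polyCts (Polynomial.monomial k c) = c • fourier k := by
  rw [polyCts, Polynomial.aeval_monomial, fourier_one_pow]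
  rfl

lemma rieszCts_polyCts {q : ℝ≥0∞} [Fact (1 ≤ q)] (hq : q ≤ 2) (Q : Polynomial ℂ) :
    rieszCts hq (polyCts Q) = ctsLp q (polyCts Q) := by
  induction Q using Polynomial.induction_on' with
  | add P Q hP hQ =>
    have : polyCts (P + Q) = polyCts P + polyCts Q := map_add _ _ _
    rw [this, map_add, map_add, hP, hQ]
  | monomial k c =>
    rw [polyCts_monomial, map_smul, map_smul, rieszCts_fourier, if_pos (by positivity)]

lemma star_fourier (k : ℤ) : star (fourier k : C(UnitAddCircle, ℂ)) = fourier (-k) := by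
  ext t
  rw [fourier_neg]
  rfl

/-- The conjugate of an analytic polynomial has no positive frequencies, so only its constant term
survives. -/
lemma rieszCts_star_polyCts {q : ℝ≥0∞} [Fact (1 ≤ q)] (hq : q ≤ 2) (Q : Polynomial ℂ) :
    rieszCts hq (star (polyCts Q)) = star (Q.eval 0) • ctsLp q (fourier 0) := by
  induction Q using Polynomial.induction_on' with
  | add P Q hP hQ =>
    have : polyCts (P + Q) = polyCts P + polyCts Q := map_add _ _ _
    rw [this, star_add, map_add, hP, hQ, Polynomial.eval_add, star_add, add_smul]
  | monomial k c =>
    rw [polyCts_monomial, star_smul, map_smul, star_fourier, rieszCts_fourier,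
      Polynomial.eval_monomial]
    rcases Nat.eq_zero_or_pos k with rfl | hk
    · simp
    · rw [if_neg (by omega)]
      simp [hk.ne']

lemma exists_polyCts_of_mem_span {s : C(UnitAddCircle, ℂ)}
    (hs : s ∈ Submodule.span ℂ (Set.range (fourier (T := 1)))) :
    ∃ P Q : Polynomial ℂ, s = polyCts P + star (polyCts Q) := by
  induction hs using Submodule.span_induction with
  | mem x h =>
    obtain ⟨k, rfl⟩ := h
    rcases Int.le_total 0 k with hk | hk
    · lift k to ℕ using hk
      exact ⟨Polynomial.monomial k 1, 0, by
        rw [polyCts_monomial, one_smul]; simp [polyCts]⟩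
    · obtain ⟨j, rfl⟩ := Int.exists_eq_neg_ofNat hk
      exact ⟨0, Polynomial.monomial j 1, by
        rw [polyCts_monomial, one_smul, star_fourier]; simp [polyCts]⟩
  | zero => exact ⟨0, 0, by simp [polyCts]⟩
  | add x y _ _ hx hy =>
    obtain ⟨P, Q, rfl⟩ := hx
    obtain ⟨P', Q', rfl⟩ := hy
    exact ⟨P + P', Q + Q', by simp only [polyCts, map_add, star_add]; abel⟩
  | smul c x _ hx =>
    obtain ⟨P, Q, rfl⟩ := hx
    exact ⟨c • P, star c • Q, by simp [polyCts]⟩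

/-- Real trigonometric polynomials are real parts of analytic polynomials that are real at `0`. -/
lemma exists_re_polyCts_of_mem_span {s : C(UnitAddCircle, ℂ)}
    (hs : s ∈ Submodule.span ℂ (Set.range (fourier (T := 1)))) :
    ∃ Q : Polynomial ℂ, (Q.eval 0).im = 0 ∧ ∀ t, (s t).re = (polyCts Q t).re := by
  obtain ⟨P, Q, rfl⟩ := exists_polyCts_of_mem_span hs
  -- Conjugating $Q$ does not change its real part, and neither does subtracting an imaginary
  -- constant, which makes the value at $0$ real.
  refine ⟨P + Q - Polynomial.C (((P + Q).eval 0).im * Complex.I), by simp, fun t => ?_⟩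
  simp [polyCts_apply]

lemma norm_ctsLp_rpow {q : ℝ≥0∞} [hq1 : Fact (1 ≤ q)] (hq : q ≠ ∞) (f : C(UnitAddCircle, ℂ)) :
    ‖ctsLp q f‖ ^ q.toReal = ∫ t, ‖f t‖ ^ q.toReal ∂circleMeasure := by
  have hq0 : q ≠ 0 := (one_pos.trans_le hq1.out).ne'
  have h := (Lp.memLp (ctsLp q f)).eLpNorm_eq_integral_rpow_norm hq0 hq
  have h0 : (0:ℝ) ≤ ∫ t, ‖ctsLp q f t‖ ^ q.toReal ∂circleMeasure :=
    integral_nonneg fun t => by positivity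
  rw [Lp.norm_def, h, ENNReal.toReal_ofReal (by positivity),
    Real.rpow_inv_rpow h0 (ENNReal.toReal_pos hq0 hq).ne']
  refine integral_congr_ae ?_
  filter_upwards [ContinuousMap.coeFn_toLp (p := q) (𝕜 := ℂ) circleMeasure f] with t ht
  rw [ht]

/-- $Q(0)$ is the mean of $Q$, hence at most its $L^1$ norm, and the measure is a probability
measure. -/
lemma norm_smul_ctsLp_one_le {q : ℝ≥0∞} [hq1 : Fact (1 ≤ q)] (Q : Polynomial ℂ) :
    ‖Q.eval 0 • ctsLp q (fourier 0)‖ ≤ ‖ctsLp q (polyCts Q)‖ := by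
  have h1 : ‖ctsLp q (fourier 0)‖ = 1 := by
    rw [Lp.norm_def, eLpNorm_congr_ae (ContinuousMap.coeFn_toLp circleMeasure _)]
    have : ⇑(fourier 0 : C(UnitAddCircle, ℂ)) = fun _ => (1 : ℂ) := by ext; simp
    rw [this, eLpNorm_const _ (one_pos.trans_le hq1.out).ne' (NeZero.ne _)]
    simp
  rw [norm_smul, h1, mul_one]
  have h2 : ∫ t, polyCts Q t ∂circleMeasure = Q.eval 0 := by
    simp_rw [polyCts_apply]
    exact integral_comp_toCircle Q.differentiable.diffContOnCl
  rw [← h2]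
  refine (norm_integral_le_integral_norm _).trans ?_
  rw [integral_norm_eq_lintegral_enorm (polyCts Q).continuous.aestronglyMeasurable,
    ← eLpNorm_one_eq_lintegral_enorm, Lp.norm_def,
    eLpNorm_congr_ae (ContinuousMap.coeFn_toLp circleMeasure _)]
  exact ENNReal.toReal_mono
    ((memLp_top_of_bound (polyCts Q).continuous.aestronglyMeasurable ‖polyCts Q‖
      (Filter.Eventually.of_forall (polyCts Q).norm_coe_le_norm)).mono_exponent
        le_top).eLpNorm_ne_top
    (eLpNorm_le_eLpNorm_of_exponent_le hq1.out (polyCts Q).continuous.aestronglyMeasurable)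

/-! ### M. Riesz's inequality -/

/-- M. Riesz's inequality for the real part of an analytic polynomial, when it is positive. -/
lemma exists_norm_rieszCts_le_of_pos {q : ℝ≥0∞} [Fact (1 ≤ q)] (h1 : 1 < q) (h2 : q ≤ 2) :
    ∃ C : ℝ, 0 ≤ C ∧ ∀ (u : C(UnitAddCircle, ℂ)) (Q : Polynomial ℂ), (Q.eval 0).im = 0 →
      (∀ t, u t = ((polyCts Q t).re : ℂ)) → (∀ t, 0 < (u t).re) →
      ‖rieszCts h2 u‖ ≤ C * ‖ctsLp q u‖ := by
  have hqt : q ≠ ∞ := (h2.trans_lt (by simp)).ne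
  have hr1 : 1 < q.toReal := by
    rw [← ENNReal.toReal_one]; exact (ENNReal.toReal_lt_toReal (by simp) hqt).2 h1
  have hr2 : q.toReal ≤ 2 := by
    simpa using (ENNReal.toReal_le_toReal hqt (by simp : (2 : ℝ≥0∞) ≠ ∞)).2 h2
  have hr0 : 0 < q.toReal := by linarith
  obtain ⟨C, D, hC, hD, h⟩ := exists_norm_rpow_le hr1 hr2
  refine ⟨C ^ (q.toReal)⁻¹, by positivity, fun u Q hQ0 hu hpos => ?_⟩
  have hu' : u = (2⁻¹ : ℂ) • polyCts Q + (2⁻¹ : ℂ) • star (polyCts Q) := by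
    ext t
    have := Complex.re_eq_add_conj (polyCts Q t)
    simp only [hu t, this, ContinuousMap.add_apply, ContinuousMap.smul_apply,
      ContinuousMap.star_apply, smul_eq_mul, starRingEnd_apply]
    ring
  have hstar : star (Q.eval 0) = Q.eval 0 := by
    rw [← starRingEnd_apply, Complex.conj_eq_iff_im]; exact hQ0
  -- The Riesz projection of $\operatorname{Re}Q$ is $(Q+Q(0))/2$, as $Q(0)$ is real.
  have hR : ‖rieszCts h2 u‖ ≤ ‖ctsLp q (polyCts Q)‖ := by
    rw [hu', map_add, map_smul, map_smul, rieszCts_polyCts, rieszCts_star_polyCts, hstar]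
    refine (norm_add_le _ _).trans ?_
    have := norm_smul_ctsLp_one_le (q := q) Q
    rw [norm_smul (2⁻¹ : ℂ), norm_smul (2⁻¹ : ℂ)]
    norm_num
    linarith
  refine hR.trans ?_
  have hsph : ∀ z ∈ Metric.sphere (0 : ℂ) 1, 0 < (Q.eval z).re := by
    intro z hz
    obtain ⟨t, ht⟩ : ∃ t : UnitAddCircle, fourier 1 t = z := by
      refine ⟨(AddCircle.homeomorphCircle one_ne_zero).symm ⟨z, hz⟩, ?_⟩
      rw [fourier_one, ← AddCircle.homeomorphCircle_apply one_ne_zero]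
      exact congrArg Subtype.val (Homeomorph.apply_symm_apply _ (⟨z, hz⟩ : Circle))
    have := hpos t
    rwa [hu t, Complex.ofReal_re, polyCts_apply, ht] at this
  have key := integral_norm_rpow_le hD h Q.differentiable hsph hQ0
  have e1 : ∫ t, ‖Q.eval (fourier 1 t)‖ ^ q.toReal ∂circleMeasure =
      ‖ctsLp q (polyCts Q)‖ ^ q.toReal := by
    simp_rw [norm_ctsLp_rpow hqt, polyCts_apply]
  have e2 : ∫ t, (Q.eval (fourier 1 t)).re ^ q.toReal ∂circleMeasure =
      ‖ctsLp q u‖ ^ q.toReal := by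
    rw [norm_ctsLp_rpow hqt]
    refine integral_congr_ae (Filter.Eventually.of_forall fun t => ?_)
    have := hpos t
    simp only [hu t, Complex.ofReal_re, polyCts_apply] at this ⊢
    rw [Complex.norm_real, Real.norm_of_nonneg this.le]
  rw [e1, e2] at key
  have := Real.rpow_le_rpow (by positivity) key (inv_nonneg.2 hr0.le)
  rwa [Real.mul_rpow hC (by positivity), Real.rpow_rpow_inv (norm_nonneg _) hr0.ne',
    Real.rpow_rpow_inv (norm_nonneg _) hr0.ne'] at this

/-- A real function on the circle, as a complex one. -/
def ofRealCts (g : C(UnitAddCircle, ℝ)) : C(UnitAddCircle, ℂ) := ⟨fun t => (g t : ℂ), by fun_prop⟩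

/-- The inequality with a fixed constant is closed under uniform limits, so it passes from strictly
positive real trigonometric polynomials to their limits. -/
lemma exists_norm_rieszCts_le_of_nonneg {q : ℝ≥0∞} [Fact (1 ≤ q)] (h1 : 1 < q) (h2 : q ≤ 2) :
    ∃ C : ℝ, 0 ≤ C ∧ ∀ g : C(UnitAddCircle, ℝ), 0 ≤ g →
      ‖rieszCts h2 (ofRealCts g)‖ ≤ C * ‖ctsLp q (ofRealCts g)‖ := by
  obtain ⟨C, hC, h⟩ := exists_norm_rieszCts_le_of_pos h1 h2
  refine ⟨C, hC, fun g hg => ?_⟩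
  have hclosed : IsClosed {u : C(UnitAddCircle, ℂ) | ‖rieszCts h2 u‖ ≤ C * ‖ctsLp q u‖} :=
    isClosed_le (by fun_prop) (by fun_prop)
  refine hclosed.closure_subset (Metric.mem_closure_iff.2 fun ε hε => ?_)
  -- Shifting $g$ up by $\varepsilon/3$ before approximating within $\varepsilon/3$ makes the
  -- approximant positive, with total error below $2\varepsilon/3$.
  have hmem : ofRealCts g + algebraMap ℂ _ ((ε / 3 : ℝ) : ℂ) ∈
      (Submodule.span ℂ (Set.range (fourier (T := 1)))).topologicalClosure := by
    rw [span_fourier_closure_eq_top]; trivial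
  obtain ⟨s, hs, hsd⟩ := Metric.mem_closure_iff.1 hmem (ε / 3) (by positivity)
  obtain ⟨Q, hQ0, hQ⟩ := exists_re_polyCts_of_mem_span hs
  have hbd : ∀ t, |(s t).re - (g t + ε / 3)| < ε / 3 := fun t => by
    have h3 := (ContinuousMap.dist_apply_le_dist (f := s) (g := _) t).trans_lt
      (by rw [dist_comm]; exact hsd)
    rw [dist_eq_norm] at h3
    refine lt_of_le_of_lt ?_ h3
    refine le_trans (le_of_eq ?_) (Complex.abs_re_le_norm _)
    simp [ofRealCts, Algebra.algebraMap_eq_smul_one]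
  let u : C(UnitAddCircle, ℂ) := ofRealCts ⟨fun t => (s t).re, by fun_prop⟩
  refine ⟨u, h u Q hQ0 (fun t => by rw [← hQ]; rfl) (fun t => ?_), ?_⟩
  · have := abs_lt.1 (hbd t)
    have h4 : 0 ≤ g t := hg t
    change 0 < ((s t).re : ℂ).re
    rw [Complex.ofReal_re]
    linarith
  · refine (ContinuousMap.dist_lt_iff hε).2 fun t => ?_
    have := abs_lt.1 (hbd t)
    change dist (g t : ℂ) ((s t).re : ℂ) < ε
    rw [Complex.dist_eq, ← Complex.ofReal_sub, Complex.norm_real, Real.norm_eq_abs, abs_lt]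
    constructor <;> linarith

/-- M. Riesz's inequality for continuous functions, for `1 < q ≤ 2`. -/
lemma exists_norm_rieszCts_le {q : ℝ≥0∞} [Fact (1 ≤ q)] (h1 : 1 < q) (h2 : q ≤ 2) :
    ∃ C : ℝ, ∀ f : C(UnitAddCircle, ℂ), ‖rieszCts h2 f‖ ≤ C * ‖ctsLp q f‖ := by
  obtain ⟨C, hC, h⟩ := exists_norm_rieszCts_le_of_nonneg h1 h2
  refine ⟨4 * C, fun f => ?_⟩
  let re : C(UnitAddCircle, ℝ) := ⟨fun t => (f t).re, by fun_prop⟩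
  let im : C(UnitAddCircle, ℝ) := ⟨fun t => (f t).im, by fun_prop⟩
  have hb : ∀ g : C(UnitAddCircle, ℝ), (∀ t, |g t| ≤ ‖f t‖) →
      ‖rieszCts h2 (ofRealCts (g ⊔ 0))‖ ≤ C * ‖ctsLp q f‖ := fun g hg => by
    refine (h _ le_sup_right).trans (mul_le_mul_of_nonneg_left ?_ hC)
    refine Lp.norm_le_norm_of_ae_le ?_
    filter_upwards [ContinuousMap.coeFn_toLp (p := q) (𝕜 := ℂ) circleMeasure f,
      ContinuousMap.coeFn_toLp (p := q) (𝕜 := ℂ) circleMeasure (ofRealCts (g ⊔ 0))] with t h3 h4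
    rw [h3, h4]
    refine le_trans ?_ (hg t)
    change ‖((max (g t) 0 : ℝ) : ℂ)‖ ≤ _
    rw [Complex.norm_real, Real.norm_of_nonneg (le_max_right _ _)]
    exact max_le (le_abs_self _) (abs_nonneg _)
  -- Each of these four nonnegative parts is dominated pointwise by $|f|$, whence the constant $4C$.
  have hf : f = ofRealCts (re ⊔ 0) - ofRealCts ((-re) ⊔ 0) +
      Complex.I • (ofRealCts (im ⊔ 0) - ofRealCts ((-im) ⊔ 0)) := by
    have hmax : ∀ x : ℝ, max x 0 - max (-x) 0 = x := fun x => by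
      rcases le_total 0 x with hx | hx
      · rw [max_eq_left hx, max_eq_right (by linarith), sub_zero]
      · rw [max_eq_right hx, max_eq_left (by linarith)]; ring
    ext t
    change f t = ((max (f t).re 0 : ℝ) : ℂ) - ((max (-(f t).re) 0 : ℝ) : ℂ) +
      Complex.I * (((max (f t).im 0 : ℝ) : ℂ) - ((max (-(f t).im) 0 : ℝ) : ℂ))
    rw [← Complex.ofReal_sub, ← Complex.ofReal_sub, hmax, hmax, mul_comm, Complex.re_add_im]
  have hre : ∀ t, |re t| ≤ ‖f t‖ := fun t => Complex.abs_re_le_norm _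
  have him : ∀ t, |im t| ≤ ‖f t‖ := fun t => Complex.abs_im_le_norm _
  have b1 := hb re hre
  have b2 := hb (-re) fun t => by simpa using hre t
  have b3 := hb im him
  have b4 := hb (-im) fun t => by simpa using him t
  have hR : rieszCts h2 f = rieszCts h2 (ofRealCts (re ⊔ 0)) - rieszCts h2 (ofRealCts ((-re) ⊔ 0)) +
      Complex.I • (rieszCts h2 (ofRealCts (im ⊔ 0)) - rieszCts h2 (ofRealCts ((-im) ⊔ 0))) := by
    conv_lhs => rw [hf]
    simp only [map_add, map_sub, map_smul]
  rw [hR]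
  refine (norm_add_le _ _).trans ?_
  rw [norm_smul, Complex.norm_I, one_mul]
  refine (add_le_add (norm_sub_le _ _) (norm_sub_le _ _)).trans ?_
  linarith

/-- M. Riesz: the Riesz projection is bounded on scalar `L^q`, `1 < q ≤ 2`. -/
theorem exists_scalar_riesz_projection {q : ℝ≥0∞} [Fact (1 ≤ q)] (h1 : 1 < q) (h2 : q ≤ 2) :
    ∃ T : Lp ℂ q circleMeasure →L[ℂ] Lp ℂ q circleMeasure,
      ∀ k : ℤ, T (fourierLp q k) = if 0 ≤ k then fourierLp q k else 0 := by
  have hqt : q ≠ ∞ := (h2.trans_lt (by simp)).ne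
  refine ⟨(rieszCts h2).toLinearMap.extendOfNorm (ctsLp q).toLinearMap, fun k => ?_⟩
  rw [← rieszCts_fourier h2 k]
  exact LinearMap.extendOfNorm_eq (f := (rieszCts h2).toLinearMap) (e := (ctsLp q).toLinearMap)
    (ContinuousMap.toLp_denseRange ℂ circleMeasure ℂ hqt) (exists_norm_rieszCts_le h1 h2)
    (fourier k)

/-! ### Fourier coefficients and spectral projections on scalar $L^q$ -/

section Scalar

variable {q : ℝ≥0∞} [Fact (1 ≤ q)]

instance fact_one_le_conjExponent : Fact (1 ≤ ENNReal.conjExponent q) :=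
  ⟨by simp [ENNReal.conjExponent]⟩

/-- The pairing `f ↦ ∫ ψ f` with a bounded function, as a functional on `L^q`. -/
lemma exists_pairing {ψ : UnitAddCircle → ℂ} (hψ : MemLp ψ ∞ circleMeasure) :
    ∃ L : Lp ℂ q circleMeasure →L[ℂ] ℂ, ∀ f, L f = ∫ t, ψ t * f t ∂circleMeasure := by
  refine ⟨((ContinuousLinearMap.mul ℂ ℂ).lpPairing circleMeasure q (ENNReal.conjExponent q)).flip
    ((hψ.mono_exponent le_top).toLp), fun f => ?_⟩
  rw [ContinuousLinearMap.flip_apply, ContinuousLinearMap.lpPairing_eq_integral]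
  refine integral_congr_ae ?_
  filter_upwards [(hψ.mono_exponent (p := ENNReal.conjExponent q) le_top).coeFn_toLp] with t ht
  rw [ht, ContinuousLinearMap.mul_apply', mul_comm]

lemma memLp_top_fourier (k : ℤ) :
    MemLp (fourier k : C(UnitAddCircle, ℂ)) ∞ circleMeasure :=
  memLp_top_of_bound (fourier k).continuous.aestronglyMeasurable 1
    (Filter.Eventually.of_forall fun t => by rw [fourier_apply, Circle.norm_coe])

/-- The Fourier coefficients of `φ f`, for bounded `φ`, as functionals of `f`. -/
lemma exists_fourierCoeff_mul {φ : UnitAddCircle → ℂ} (hφ : MemLp φ ∞ circleMeasure) (k : ℤ) :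
    ∃ L : Lp ℂ q circleMeasure →L[ℂ] ℂ, ∀ f, L f = fourierCoeff (fun t => φ t * f t) k := by
  obtain ⟨L, hL⟩ := exists_pairing (q := q) (hφ.mul' (r := ∞) (memLp_top_fourier (-k)))
  refine ⟨L, fun f => ?_⟩
  rw [hL, fourierCoeff]
  simp only [smul_eq_mul, mul_assoc]

lemma exists_fourierCoeffCLM (k : ℤ) :
    ∃ L : Lp ℂ q circleMeasure →L[ℂ] ℂ, ∀ f, L f = fourierCoeff f k := by
  obtain ⟨L, hL⟩ := exists_fourierCoeff_mul (q := q) (memLp_const (1 : ℂ)) k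
  exact ⟨L, fun f => by simpa using hL f⟩

lemma fourierCoeff_mul_fourier (φ : UnitAddCircle → ℂ) (j k : ℤ) :
    fourierCoeff (fun t => φ t * fourier j t) k = fourierCoeff φ (k - j) := by
  simp only [fourierCoeff, smul_eq_mul]
  congr 1
  ext t
  rw [neg_sub, sub_eq_neg_add, fourier_add]
  ring

lemma fourierCoeff_mul_fourierLp (φ : UnitAddCircle → ℂ) (j k : ℤ) :
    fourierCoeff (fun t => φ t * fourierLp q j t) k = fourierCoeff φ (k - j) := by
  rw [← fourierCoeff_mul_fourier]
  refine congrFun (fourierCoeff_congr_ae ?_) k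
  filter_upwards [coeFn_fourierLp q j] with t ht
  rw [ht]

lemma fourierCoeff_fourierLp (j k : ℤ) :
    fourierCoeff (fourierLp (T := 1) q j) k = if k = j then 1 else 0 := by
  rw [congrFun (fourierCoeff_congr_ae (coeFn_fourierLp q j)) k, fourierCoeff_fourier]
  simp [Pi.single_apply]

lemma clm_ext_fourierLp {E : Type*} [NormedAddCommGroup E] [NormedSpace ℂ E] (hq : q ≠ ∞)
    {L L' : Lp ℂ q circleMeasure →L[ℂ] E} (h : ∀ k, L (fourierLp q k) = L' (fourierLp q k)) :
    L = L' := by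
  refine ContinuousLinearMap.ext_on (s := Set.range (fourierLp q)) ?_ ?_
  · exact Submodule.dense_iff_topologicalClosure_eq_top.2 (span_fourierLp_closure_eq_top hq)
  · rintro _ ⟨k, rfl⟩
    exact h k

/-- As $q>1$, the conjugate exponent is finite and characters span a dense subspace of its $L^{q'}$.
Hence the functional $\int f\,\cdot$ vanishes on $L^{q'}$, in particular on indicators. -/
lemma eq_zero_of_fourierCoeff_eq_zero (h1 : 1 < q) (f : Lp ℂ q circleMeasure)
    (h : ∀ k, fourierCoeff f k = 0) : f = 0 := by
  set q' := ENNReal.conjExponent q with hq'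
  have hqt : q' ≠ ∞ := by
    simpa [hq', ENNReal.conjExponent, tsub_eq_zero_iff_le] using h1
  have hL : (ContinuousLinearMap.mul ℂ ℂ).lpPairing circleMeasure q q' f = 0 := by
    refine clm_ext_fourierLp hqt fun k => ?_
    rw [ContinuousLinearMap.lpPairing_eq_integral, zero_apply, ← h (-k),
      fourierCoeff]
    refine integral_congr_ae ?_
    filter_upwards [coeFn_fourierLp q' k] with t ht
    rw [ht, ContinuousLinearMap.mul_apply', mul_comm, neg_neg, smul_eq_mul]
  refine (Lp.eq_zero_iff_ae_eq_zero).2 (Integrable.ae_eq_zero_of_forall_setIntegral_eq_zero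
    ((Lp.memLp f).integrable Fact.out) fun s hs _ => ?_)
  have h2 := DFunLike.congr_fun hL (indicatorConstLp q' hs (measure_ne_top _ _) 1)
  rw [ContinuousLinearMap.lpPairing_eq_integral, zero_apply] at h2
  rw [← h2, ← integral_indicator hs]
  refine integral_congr_ae ?_
  filter_upwards [indicatorConstLp_coeFn (p := q') (hs := hs)
    (hμs := measure_ne_top circleMeasure s) (c := (1 : ℂ))] with t ht
  rw [ht, ContinuousLinearMap.mul_apply']
  by_cases hts : t ∈ s <;> simp [hts]

/-- `S` is a Fourier multiplier with symbol the indicator of `J`. -/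
def IsSpectralProjection (S : Lp ℂ q circleMeasure →L[ℂ] Lp ℂ q circleMeasure) (J : Set ℤ) : Prop :=
  ∀ k : ℤ, (k ∈ J → S (fourierLp q k) = fourierLp q k) ∧ (k ∉ J → S (fourierLp q k) = 0)

variable {S : Lp ℂ q circleMeasure →L[ℂ] Lp ℂ q circleMeasure} {J : Set ℤ}

lemma IsSpectralProjection.compl (hS : IsSpectralProjection S J) :
    IsSpectralProjection (ContinuousLinearMap.id ℂ _ - S) Jᶜ := fun k =>
  ⟨fun hk => by simp [(hS k).2 hk], fun hk => by simp [(hS k).1 (not_not.1 hk)]⟩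

lemma exists_isSpectralProjection_nonneg (h1 : 1 < q) (h2 : q ≤ 2) :
    ∃ S : Lp ℂ q circleMeasure →L[ℂ] Lp ℂ q circleMeasure,
      IsSpectralProjection S {k | 0 ≤ k} := by
  obtain ⟨T, hT⟩ := exists_scalar_riesz_projection h1 h2
  exact ⟨T, fun k => ⟨fun hk => by rw [hT]; exact if_pos hk, fun hk => by rw [hT]; exact if_neg hk⟩⟩

lemma exists_isSpectralProjection_singleton (k : ℤ) :
    ∃ S : Lp ℂ q circleMeasure →L[ℂ] Lp ℂ q circleMeasure, IsSpectralProjection S {k} := by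
  obtain ⟨L, hL⟩ := exists_fourierCoeffCLM (q := q) k
  refine ⟨L.smulRight (fourierLp q k), fun j => ⟨fun hj => ?_, fun hj => ?_⟩⟩
  · rw [Set.mem_singleton_iff.1 hj, ContinuousLinearMap.smulRight_apply, hL,
      fourierCoeff_fourierLp, if_pos rfl, one_smul]
  · rw [ContinuousLinearMap.smulRight_apply, hL, fourierCoeff_fourierLp,
      if_neg fun h => hj h.symm, zero_smul]

/-- For fixed $k$ the coefficient is a continuous functional of $f$, so it is enough to take $f$ a
character, where it is zero or a shifted coefficient of $\varphi$. This replaces the convolution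
formula for the coefficients of a product. -/
lemma IsSpectralProjection.fourierCoeff_mul_eq_zero (hq : q ≠ ∞) (hS : IsSpectralProjection S J)
    {φ : UnitAddCircle → ℂ} (hφ : MemLp φ ∞ circleMeasure) {k : ℤ}
    (h : ∀ j ∈ J, fourierCoeff φ (k - j) = 0) (f : Lp ℂ q circleMeasure) :
    fourierCoeff (fun t => φ t * S f t) k = 0 := by
  obtain ⟨L, hL⟩ := exists_fourierCoeff_mul (q := q) hφ k
  have : L ∘L S = 0 := clm_ext_fourierLp hq fun j => by
    by_cases hj : j ∈ J
    · rw [ContinuousLinearMap.comp_apply, (hS j).1 hj, hL, fourierCoeff_mul_fourierLp, h j hj]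
      rfl
    · rw [ContinuousLinearMap.comp_apply, (hS j).2 hj, map_zero]
      rfl
  rw [← hL]
  exact DFunLike.congr_fun this f

lemma fourierCoeff_one (k : ℤ) (hk : k ≠ 0) :
    fourierCoeff (fun _ : UnitAddCircle => (1 : ℂ)) k = 0 := by
  have h := congrFun (fourierCoeff_fourier (T := 1) 0) k
  rw [Pi.single_eq_of_ne hk] at h
  rw [← h]
  congr 1
  ext
  simp

lemma IsSpectralProjection.fourierCoeff_eq_zero (hq : q ≠ ∞) (hS : IsSpectralProjection S J)
    (f : Lp ℂ q circleMeasure) {k : ℤ} (hk : k ∉ J) : fourierCoeff (S f) k = 0 := by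
  simpa using hS.fourierCoeff_mul_eq_zero hq (φ := fun _ => 1) (memLp_const 1) (k := k)
    (fun j hj => fourierCoeff_one _ fun h => hk (by rwa [sub_eq_zero.1 h])) f

lemma fourierCoeff_sub_Lp (f g : Lp ℂ q circleMeasure) (k : ℤ) :
    fourierCoeff (f - g : Lp ℂ q circleMeasure) k = fourierCoeff f k - fourierCoeff g k := by
  obtain ⟨L, hL⟩ := exists_fourierCoeffCLM (q := q) k
  rw [← hL, ← hL, ← hL, map_sub]

/-- All coefficients of $f-Sf$ vanish: those in $J$ because $I-S$ is the projection for the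
complement, the others because both terms have none. -/
lemma IsSpectralProjection.apply_eq_self (h1 : 1 < q) (hq : q ≠ ∞) (hS : IsSpectralProjection S J)
    {f : Lp ℂ q circleMeasure} (hf : ∀ k ∉ J, fourierCoeff f k = 0) : S f = f := by
  rw [← sub_eq_zero, ← neg_eq_zero, neg_sub]
  refine eq_zero_of_fourierCoeff_eq_zero h1 _ fun k => ?_
  by_cases hk : k ∈ J
  · exact hS.compl.fourierCoeff_eq_zero hq f (not_not.2 hk)
  · rw [fourierCoeff_sub_Lp, hf k hk, hS.fourierCoeff_eq_zero hq f hk, sub_zero]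

end Scalar

/-! ### Vector functions: the Riesz decomposition and matrix multiplication -/

lemma fourierCoeff_eval {n : ℕ} {f : UnitAddCircle → EuclideanSpace ℂ (Fin n)}
    (hf : Integrable f circleMeasure) (k : ℤ) (i : Fin n) :
    fourierCoeff f k i = fourierCoeff (fun t => f t i) k := by
  have h : Integrable (fun t => fourier (-k) t • f t) circleMeasure := hf.fourier_smul (-k)
  simp only [fourierCoeff]
  rw [eval_integral_piLp (fun j => h.eval_piLp j)]
  rfl

/-- A component of a vector function, as a class in `L^q`. -/
def component {n : ℕ} {q : ℝ≥0∞} (f : VecLp n q) (i : Fin n) : Lp ℂ q circleMeasure :=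
  ((Lp.memLp f).eval_piLp i).toLp

lemma coeFn_component {n : ℕ} {q : ℝ≥0∞} (f : VecLp n q) (i : Fin n) :
    component f i =ᵐ[circleMeasure] fun t => f t i :=
  ((Lp.memLp f).eval_piLp i).coeFn_toLp

lemma fourierCoeff_component {n : ℕ} {q : ℝ≥0∞} [Fact (1 ≤ q)] (f : VecLp n q) (i : Fin n)
    (k : ℤ) : fourierCoeff (component f i) k = fourierCoeff f k i := by
  rw [congrFun (fourierCoeff_congr_ae (coeFn_component f i)) k,
    fourierCoeff_eval (VecLp.integrable f)]

lemma fourierCoeff_eq_zero_iff {n : ℕ} {q : ℝ≥0∞} [Fact (1 ≤ q)] (f : VecLp n q) (k : ℤ) :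
    fourierCoeff f k = 0 ↔ ∀ i, fourierCoeff (component f i) k = 0 := by
  simp_rw [fourierCoeff_component]
  exact ⟨fun h i => by rw [h]; rfl, fun h => by ext i; exact h i⟩

/-- The vector function with given components. -/
def ofComponents {n : ℕ} {q : ℝ≥0∞} (g : Fin n → Lp ℂ q circleMeasure) : VecLp n q :=
  (MemLp.of_eval_piLp (f := fun t => (WithLp.toLp 2 fun i => g i t : EuclideanSpace ℂ (Fin n)))
    fun i => Lp.memLp (g i)).toLp

lemma coeFn_ofComponents {n : ℕ} {q : ℝ≥0∞} (g : Fin n → Lp ℂ q circleMeasure) :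
    ofComponents g =ᵐ[circleMeasure] fun t => WithLp.toLp 2 fun i => g i t :=
  MemLp.coeFn_toLp _

lemma component_ofComponents {n : ℕ} {q : ℝ≥0∞} (g : Fin n → Lp ℂ q circleMeasure) (i : Fin n) :
    component (ofComponents g) i = g i := by
  refine Lp.ext ?_
  filter_upwards [coeFn_component (ofComponents g) i, coeFn_ofComponents g] with t h1 h2
  rw [h1, h2]

lemma component_ext {n : ℕ} {q : ℝ≥0∞} {f g : VecLp n q}
    (h : ∀ i, component f i = component g i) : f = g := by
  refine Lp.ext ?_
  have h1 := ae_all_iff.2 (coeFn_component f)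
  have h2 := ae_all_iff.2 (coeFn_component g)
  filter_upwards [h1, h2] with t h3 h4
  ext i
  rw [← h3, ← h4, h]

lemma component_sub {n : ℕ} {q : ℝ≥0∞} (f g : VecLp n q) (i : Fin n) :
    component (f - g) i = component f i - component g i := by
  refine Lp.ext ?_
  filter_upwards [coeFn_component (f - g) i, coeFn_component f i, coeFn_component g i,
    Lp.coeFn_sub f g, Lp.coeFn_sub (component f i) (component g i)] with t h1 h2 h3 h4 h5
  rw [h1, h5, h4, Pi.sub_apply, Pi.sub_apply, h2, h3]
  rfl

/-- M. Riesz: `(L^q)^n` is the direct sum of `(H^q)^n` and the conjugates of the functions in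
`(H^q)^n` that vanish at `0`, for `1 < q ≤ 2`. -/
theorem isCompl_hardy {n : ℕ} {q : ℝ≥0∞} [Fact (1 ≤ q)] (h1 : 1 < q) (h2 : q ≤ 2) :
    IsCompl (hardy n q) (conjHardyZero n q) := by
  have hqt : q ≠ ∞ := (h2.trans_lt (by simp)).ne
  obtain ⟨S, hS⟩ := exists_isSpectralProjection_nonneg h1 h2
  constructor
  · rw [Submodule.disjoint_def]
    intro f hf hf'
    have h0 : ∀ k, fourierCoeff f k = 0 := fun k => by
      rcases lt_or_ge k 0 with hk | hk
      · exact hf k hk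
      · exact hf' k hk
    refine component_ext fun i => ?_
    rw [eq_zero_of_fourierCoeff_eq_zero h1 (component f i) fun k =>
        (fourierCoeff_eq_zero_iff f k).1 (h0 k) i,
      eq_zero_of_fourierCoeff_eq_zero h1 (component (0 : VecLp n q) i) fun k =>
        (fourierCoeff_eq_zero_iff _ k).1 (fourierCoeff_zero' k) i]
  · rw [codisjoint_iff, eq_top_iff]
    intro f _
    -- The analytic part, obtained by applying the scalar Riesz projection to each component.
    set g : VecLp n q := ofComponents fun i => S (component f i) with hg
    rw [← add_sub_cancel g f]
    refine Submodule.add_mem_sup (fun k hk => ?_) (fun k hk => ?_)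
    · rw [fourierCoeff_eq_zero_iff]
      intro i
      rw [hg, component_ofComponents]
      exact hS.fourierCoeff_eq_zero hqt _ (not_le.2 hk)
    · rw [fourierCoeff_eq_zero_iff]
      intro i
      rw [component_sub, hg, component_ofComponents]
      exact hS.compl.fourierCoeff_eq_zero hqt _ (not_not.2 hk)

lemma coeFn_mulLp {n : ℕ} {p r q : ℝ≥0∞} [ENNReal.HolderTriple p r q]
    {M : UnitAddCircle → Matrix (Fin n) (Fin n) ℂ} (hM : MemMatLp p M) (f : VecLp n r) :
    (mulLp M hM f : VecLp n q) =ᵐ[circleMeasure]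
      fun t => WithLp.toLp 2 ((M t).mulVec (f t).ofLp) :=
  (hM.memLp_mulVec f).coeFn_toLp

/-- Spectra add under multiplication. Entrywise this is the scalar statement, since a component with
spectrum in $J$ is fixed by $S$. -/
lemma IsSpectralProjection.fourierCoeff_mulLp_eq_zero {n : ℕ} {q : ℝ≥0∞} [Fact (1 ≤ q)]
    {S : Lp ℂ q circleMeasure →L[ℂ] Lp ℂ q circleMeasure} {J : Set ℤ} (h1 : 1 < q) (hq : q ≠ ∞)
    (hS : IsSpectralProjection S J) {M : UnitAddCircle → Matrix (Fin n) (Fin n) ℂ}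
    (hM : MemMatLp ∞ M) {k : ℤ}
    (h : ∀ i l, ∀ j ∈ J, fourierCoeff (fun t => M t i l) (k - j) = 0) {f : VecLp n q}
    (hf : ∀ j ∉ J, fourierCoeff f j = 0) :
    fourierCoeff (mulLp (r := q) (q := q) M hM f) k = 0 := by
  rw [fourierCoeff_eq_zero_iff]
  intro i
  have hae : component (mulLp (r := q) (q := q) M hM f) i =ᵐ[circleMeasure]
      ∑ l, fun t => M t i l * component f l t := by
    filter_upwards [coeFn_component (mulLp (r := q) (q := q) M hM f) i, coeFn_mulLp (q := q) hM f,
      ae_all_iff.2 (coeFn_component f)] with t h2 h3 h4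
    rw [h2, h3, Finset.sum_apply]
    simp [Matrix.mulVec, dotProduct, h4]
  have hint : ∀ l, MemLp (fun t => M t i l * component f l t) q circleMeasure := fun l =>
    (Lp.memLp (component f l)).mul' (hM i l)
  rw [congrFun (fourierCoeff_congr_ae hae) k, fourierCoeff.sum _ _ fun l _ =>
    (hint l).integrable Fact.out, Finset.sum_apply]
  refine Finset.sum_eq_zero fun l _ => ?_
  have hSf := hS.apply_eq_self h1 hq (f := component f l) fun j hj =>
    (fourierCoeff_eq_zero_iff f j).1 (hf j hj) l
  rw [← hSf]
  exact hS.fourierCoeff_mul_eq_zero hq (hM i l) (h i l) _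

lemma mulLp_mem_hardy {n : ℕ} {q : ℝ≥0∞} [Fact (1 ≤ q)] (h1 : 1 < q) (h2 : q ≤ 2)
    {M : UnitAddCircle → Matrix (Fin n) (Fin n) ℂ} (hM : MemMatLp ∞ M)
    (h : ∀ i l, ∀ k < 0, fourierCoeff (fun t => M t i l) k = 0) {f : VecLp n q}
    (hf : f ∈ hardy n q) : mulLp (r := q) M hM f ∈ hardy n q := by
  obtain ⟨S, hS⟩ := exists_isSpectralProjection_nonneg h1 h2
  exact fun k hk => hS.fourierCoeff_mulLp_eq_zero h1 (h2.trans_lt (by simp)).ne hM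
    (fun i l j (hj : 0 ≤ j) => h i l _ (by omega)) fun j hj => hf j (not_le.1 hj)

lemma mulLp_mem_conjHardyZero {n : ℕ} {q : ℝ≥0∞} [Fact (1 ≤ q)] (h1 : 1 < q) (h2 : q ≤ 2)
    {M : UnitAddCircle → Matrix (Fin n) (Fin n) ℂ} (hM : MemMatLp ∞ M)
    (h : ∀ i l, ∀ k > 0, fourierCoeff (fun t => M t i l) k = 0) {f : VecLp n q}
    (hf : f ∈ conjHardyZero n q) : mulLp (r := q) M hM f ∈ conjHardyZero n q := by
  obtain ⟨S, hS⟩ := exists_isSpectralProjection_nonneg h1 h2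
  exact fun k hk => hS.compl.fourierCoeff_mulLp_eq_zero h1 (h2.trans_lt (by simp)).ne hM
    (fun i l j (hj : ¬ 0 ≤ j) => h i l _ (by omega)) fun j hj => hf j (not_not.1 hj)

/-! ### Continuity of the projections and compatibility between exponents -/

section RieszProjection

variable {n : ℕ} {q : ℝ≥0∞} [Fact (1 ≤ q)]

lemma rieszPlus_mem (h : IsCompl (hardy n q) (conjHardyZero n q)) (f : VecLp n q) :
    rieszPlus n q f ∈ hardy n q := by
  rw [rieszPlus, dif_pos h]
  exact Submodule.projection_apply_mem h f

lemma rieszMinus_mem (h : IsCompl (hardy n q) (conjHardyZero n q)) (f : VecLp n q) :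
    rieszMinus n q f ∈ conjHardyZero n q := by
  rw [rieszMinus, rieszPlus, dif_pos h, LinearMap.sub_apply, LinearMap.id_apply,
    ← Submodule.projection_eq_self_sub_projection]
  exact Submodule.projection_apply_mem h.symm f

lemma rieszPlus_eq (h : IsCompl (hardy n q) (conjHardyZero n q)) {f g : VecLp n q}
    (hg : g ∈ hardy n q) (hfg : f - g ∈ conjHardyZero n q) : rieszPlus n q f = g := by
  rw [rieszPlus, dif_pos h]
  nth_rewrite 1 [← add_sub_cancel g f]
  rw [map_add, Submodule.projection_apply_of_mem_left h hg,
    (Submodule.projection_apply_eq_zero_iff h).2 hfg, add_zero]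

/-- Closed graph: both summands are closed, so a limit of decompositions is again the decomposition
of the limit. -/
lemma continuous_rieszPlus (h : IsCompl (hardy n q) (conjHardyZero n q)) :
    Continuous (rieszPlus n q) := by
  refine LinearMap.continuous_of_seq_closed_graph _ fun u x y hu hy => ?_
  refine (rieszPlus_eq h ?_ ?_).symm
  · exact isClosed_hardy.mem_of_tendsto hy (Filter.Eventually.of_forall fun k => rieszPlus_mem h _)
  · exact isClosed_conjHardyZero.mem_of_tendsto (hu.sub hy)
      (Filter.Eventually.of_forall fun k => rieszMinus_mem h (u k))

end RieszProjection

/-- Closed graph: along a common subsequence $u_k\to x$ and $Mu_k\to y$ almost everywhere, which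
forces $y=Mx$. -/
lemma continuous_mulLp {n : ℕ} {p r q : ℝ≥0∞} [ENNReal.HolderTriple p r q] [Fact (1 ≤ r)]
    [Fact (1 ≤ q)] {M : UnitAddCircle → Matrix (Fin n) (Fin n) ℂ} (hM : MemMatLp p M) :
    Continuous (mulLp M hM : VecLp n r →ₗ[ℂ] VecLp n q) := by
  refine LinearMap.continuous_of_seq_closed_graph _ fun u x y hu hy => ?_
  obtain ⟨ns, hns, hns'⟩ := (tendstoInMeasure_of_tendsto_Lp hu).exists_seq_tendsto_ae
  obtain ⟨ms, hms, hms'⟩ := (tendstoInMeasure_of_tendsto_Lp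
    (hy.comp hns.tendsto_atTop)).exists_seq_tendsto_ae
  refine Lp.ext ?_
  have hae := ae_all_iff.2 fun k => coeFn_mulLp (q := q) hM (u k)
  filter_upwards [hns', hms', hae, coeFn_mulLp (q := q) hM x] with t h1 h2 h3 h4
  rw [h4]
  refine tendsto_nhds_unique h2 ?_
  simp only [Function.comp_apply, h3]
  have hc : Continuous fun v : EuclideanSpace ℂ (Fin n) =>
      (WithLp.toLp 2 ((M t).mulVec v.ofLp) : EuclideanSpace ℂ (Fin n)) :=
    (PiLp.continuous_toLp 2 _).comp
      (Continuous.matrix_mulVec continuous_const (PiLp.continuous_ofLp 2 _))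
  exact (hc.tendsto _).comp (h1.comp hms.tendsto_atTop)

lemma fourierCoeff_lpIncl {n : ℕ} {p q : ℝ≥0∞} [Fact (1 ≤ p)] [Fact (1 ≤ q)] (hqp : q ≤ p)
    (f : VecLp n p) (k : ℤ) :
    fourierCoeff (lpIncl (EuclideanSpace ℂ (Fin n)) hqp f) k = fourierCoeff f k :=
  congrFun (fourierCoeff_congr_ae (coeFn_lpIncl hqp f)) k

lemma rieszPlus_lpIncl {n : ℕ} {p q : ℝ≥0∞} [Fact (1 ≤ p)] [Fact (1 ≤ q)] (hqp : q ≤ p)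
    (hp : IsCompl (hardy n p) (conjHardyZero n p)) (hq : IsCompl (hardy n q) (conjHardyZero n q))
    (f : VecLp n p) :
    rieszPlus n q (lpIncl _ hqp f) = lpIncl _ hqp (rieszPlus n p f) := by
  refine rieszPlus_eq hq (fun k hk => ?_) (fun k hk => ?_)
  · rw [fourierCoeff_lpIncl]
    exact rieszPlus_mem hp f k hk
  · rw [← map_sub, fourierCoeff_lpIncl]
    exact rieszMinus_mem hp f k hk

lemma mulLp_lpIncl {n : ℕ} {s s' p p' q q' : ℝ≥0∞} [Fact (1 ≤ p)] [Fact (1 ≤ p')] [Fact (1 ≤ q)]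
    [Fact (1 ≤ q')] [ENNReal.HolderTriple s p p'] [ENNReal.HolderTriple s' q q'] (hqp : q ≤ p)
    (hqp' : q' ≤ p') {M : UnitAddCircle → Matrix (Fin n) (Fin n) ℂ} (hM : MemMatLp s M)
    (hM' : MemMatLp s' M) (f : VecLp n p) :
    (mulLp M hM' (lpIncl _ hqp f) : VecLp n q') = lpIncl _ hqp' (mulLp M hM f : VecLp n p') := by
  refine Lp.ext ?_
  filter_upwards [coeFn_mulLp (q := q') hM' (lpIncl _ hqp f), coeFn_lpIncl hqp f,
    coeFn_lpIncl hqp' (mulLp M hM f : VecLp n p'), coeFn_mulLp (q := p') hM f] with t h1 h2 h3 h4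
  rw [h1, h2, h3, h4]

lemma fourierCoeff_star (φ : UnitAddCircle → ℂ) (k : ℤ) :
    fourierCoeff (fun t => star (φ t)) k = star (fourierCoeff φ (-k)) := by
  simp only [fourierCoeff, neg_neg]
  rw [← starRingEnd_apply, ← integral_conj]
  congr 1
  ext t
  simp

lemma InnerMatrix.coeff_conjTranspose {n : ℕ} (Θ : InnerMatrix n) (i l : Fin n) (k : ℤ)
    (hk : k > 0) : fourierCoeff (fun t => (Θ.toFun t).conjTranspose i l) k = 0 := by
  simp only [Matrix.conjTranspose_apply]
  rw [fourierCoeff_star, Θ.analytic l i (-k) (by omega), star_zero]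

lemma InnerMatrix.mul_mulAdjoint {n : ℕ} (Θ : InnerMatrix n) {q : ℝ≥0∞} (f : VecLp n q) :
    Θ.mul q (Θ.mulAdjoint q f) = f := by
  refine Lp.ext ?_
  filter_upwards [coeFn_mulLp (q := q) Θ.memMatLp (Θ.mulAdjoint q f),
    coeFn_mulLp (q := q) Θ.memMatLp.conjTranspose f, Θ.unitary] with t h1 h2 h3
  rw [Matrix.mem_unitaryGroup_iff, Matrix.star_eq_conjTranspose] at h3
  refine h1.trans ?_
  rw [InnerMatrix.mulAdjoint, h2, Matrix.mulVec_mulVec, h3, Matrix.one_mulVec]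

/-! ### The projection onto the model space -/

section ModelProj

variable {n : ℕ} (Θ : InnerMatrix n) {q : ℝ≥0∞} [Fact (1 ≤ q)]

lemma modelProj_mem (h1 : 1 < q) (h2 : q ≤ 2) (f : VecLp n q) :
    modelProj Θ q f ∈ modelSpace Θ q := by
  have hc := isCompl_hardy (n := n) h1 h2
  set h := rieszMinus n q (Θ.mulAdjoint q f) with hh
  have hmem : h ∈ conjHardyZero n q := rieszMinus_mem hc _
  have heq : modelProj Θ q f = rieszPlus n q (Θ.mul q h) := rfl
  -- $P_+\Theta h=\Theta h-P_-\Theta h=\Theta(h-\Theta^*P_-\Theta h)$, and $\Theta^*$, having no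
  -- positive frequencies, preserves $\overline{H^q_0}$.
  refine ⟨⟨h - Θ.mulAdjoint q (rieszMinus n q (Θ.mul q h)), Submodule.sub_mem _ hmem ?_, ?_⟩, ?_⟩
  · exact mulLp_mem_conjHardyZero h1 h2 _ Θ.coeff_conjTranspose (rieszMinus_mem hc _)
  · rw [map_sub, Θ.mul_mulAdjoint, heq, rieszMinus, LinearMap.sub_apply, LinearMap.id_apply,
      sub_sub_cancel]
  · rw [heq]
    exact rieszPlus_mem hc _

lemma continuous_modelProj (h : IsCompl (hardy n q) (conjHardyZero n q)) :
    Continuous (modelProj Θ q) := by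
  have h1 := continuous_rieszPlus h
  have h2 : Continuous (rieszMinus n q) := continuous_id.sub h1
  exact h1.comp ((continuous_mulLp Θ.memMatLp).comp (h2.comp
    (continuous_mulLp Θ.memMatLp.conjTranspose)))

lemma modelProj_lpIncl (h1 : 1 < q) (h2 : q ≤ 2) (f : VecLp n 2) :
    modelProj Θ q (lpIncl _ h2 f) = lpIncl _ h2 (modelProj Θ 2 f) := by
  have hc := isCompl_hardy (n := n) h1 h2
  have hc2 := isCompl_hardy (n := n) (q := 2) (by norm_num) le_rfl
  simp only [modelProj, rieszMinus, LinearMap.comp_apply, LinearMap.sub_apply, LinearMap.id_apply,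
    InnerMatrix.mul, InnerMatrix.mulAdjoint]
  rw [mulLp_lpIncl (p' := 2) h2 h2 Θ.memMatLp.conjTranspose, rieszPlus_lpIncl h2 hc2 hc, ← map_sub,
    mulLp_lpIncl (p' := 2) h2 h2 Θ.memMatLp, rieszPlus_lpIncl h2 hc2 hc]

lemma inner_eq_sum_component (f g : VecLp n 2) :
    inner ℂ f g = ∑ i, inner ℂ (component f i) (component g i) := by
  simp only [L2.inner_def]
  rw [← integral_finsetSum _ fun i _ => L2.integrable_inner (component f i) (component g i)]
  refine integral_congr_ae ?_
  filter_upwards [ae_all_iff.2 (coeFn_component f), ae_all_iff.2 (coeFn_component g)] with t h1 h2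
  simp only [h1, h2, PiLp.inner_apply]

lemma inner_eq_zero_of_mem {f g : VecLp n 2} (hf : f ∈ conjHardyZero n 2) (hg : g ∈ hardy n 2) :
    inner ℂ f g = 0 := by
  rw [inner_eq_sum_component]
  refine Finset.sum_eq_zero fun i _ => ?_
  rw [← (fourierBasis (T := 1)).tsum_inner_mul_inner]
  convert tsum_zero with k
  rw [← inner_conj_symm, ← HilbertBasis.repr_apply_apply, ← HilbertBasis.repr_apply_apply,
    fourierBasis_repr, fourierBasis_repr]
  rcases lt_or_ge k 0 with hk | hk
  · rw [(fourierCoeff_eq_zero_iff g k).1 (hg k hk) i, mul_zero]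
  · rw [(fourierCoeff_eq_zero_iff f k).1 (hf k hk) i, map_zero, zero_mul]

lemma InnerMatrix.inner_mul_mul (f g : VecLp n 2) :
    inner ℂ (Θ.mul 2 f) (Θ.mul 2 g) = inner ℂ f g :=
  (LinearMap.norm_map_iff_inner_map_map (Θ.mul 2)).1 Θ.norm_mul f g

/-- On `(L²)^n`, the projection `P_{Θ,2}` is the orthogonal projection onto the model space. -/
lemma modelProj_two (f : VecLp n 2) :
    modelProj Θ 2 f = ((modelSpace Θ 2).orthogonalProjectionOnto f : VecLp n 2) := by
  have h12 : (1 : ℝ≥0∞) < 2 := by norm_num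
  have hc := isCompl_hardy (n := n) (q := 2) h12 le_rfl
  rw [Submodule.coe_orthogonalProjectionOnto_apply]
  refine (Submodule.eq_starProjection_of_mem_of_inner_eq_zero (modelProj_mem Θ h12 le_rfl f)
    fun k hk => ?_).symm
  obtain ⟨⟨m, hm, hmk⟩, hkH⟩ := hk
  set w := Θ.mulAdjoint 2 f with hw
  set h := rieszMinus n 2 w with hh
  -- The residual splits into a part in $\Theta H^2$, orthogonal to $\Theta\overline{H^2_0}$, and a
  -- part in $\overline{H^2_0}$, orthogonal to $H^2$; the model space lies in both of these spaces.
  have e1 : f - modelProj Θ 2 f = Θ.mul 2 (rieszPlus n 2 w) + rieszMinus n 2 (Θ.mul 2 h) := by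
    have : modelProj Θ 2 f = rieszPlus n 2 (Θ.mul 2 h) := rfl
    rw [this, rieszMinus, LinearMap.sub_apply, LinearMap.id_apply, hh, rieszMinus,
      LinearMap.sub_apply, LinearMap.id_apply, map_sub, hw, Θ.mul_mulAdjoint]
    abel
  rw [e1, inner_add_left, inner_eq_zero_of_mem (rieszMinus_mem hc _) hkH, add_zero, ← hmk,
    Θ.inner_mul_mul, ← inner_conj_symm, inner_eq_zero_of_mem hm (rieszPlus_mem hc _), map_zero]

end ModelProj

/-! ### Bounded functions in the model space -/

/-- The vector-valued character `t ↦ exp (2 π i k t) v`. -/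
def trigVec {n : ℕ} (k : ℤ) (v : EuclideanSpace ℂ (Fin n)) : VecLp n ∞ :=
  (MemLp.smul (r := ∞) (memLp_top_const v) (memLp_top_fourier k)).toLp

lemma coeFn_trigVec {n : ℕ} (k : ℤ) (v : EuclideanSpace ℂ (Fin n)) :
    trigVec k v =ᵐ[circleMeasure] fun t => fourier k t • v :=
  (MemLp.smul (r := ∞) (memLp_top_const v) (memLp_top_fourier k)).coeFn_toLp

lemma fourierCoeff_trigVec {n : ℕ} (k j : ℤ) (v : EuclideanSpace ℂ (Fin n)) :
    fourierCoeff (trigVec k v) j = if j = k then v else 0 := by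
  rw [congrFun (fourierCoeff_congr_ae (coeFn_trigVec k v)) j]
  have h := congrFun (fourierCoeff_fourier (T := 1) k) j
  simp only [fourierCoeff, ← smul_assoc] at h ⊢
  rw [integral_smul_const, h]
  simp [Pi.single_apply]

lemma inner_trigVec {n : ℕ} (k : ℤ) (v : EuclideanSpace ℂ (Fin n)) (x : VecLp n 2) :
    inner ℂ (lpIncl _ le_top (trigVec k v) : VecLp n 2) x = inner ℂ v (fourierCoeff x k) := by
  have hx : Integrable (fun t => fourier (-k) t • x t) circleMeasure :=
    (VecLp.integrable x).fourier_smul (-k)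
  rw [L2.inner_def, fourierCoeff, ← integral_inner hx]
  refine integral_congr_ae ?_
  filter_upwards [coeFn_lpIncl (p := ∞) (q := 2) le_top (trigVec k v), coeFn_trigVec k v]
    with t h1 h2
  rw [h1, h2, inner_smul_left, inner_smul_right, fourier_neg]

/-- The projection of an analytic trigonometric polynomial to the model space is bounded. -/
lemma exists_lpIncl_eq_modelProj_trigVec {n : ℕ} (Θ : InnerMatrix n) (k : ℕ)
    (v : EuclideanSpace ℂ (Fin n)) :
    ∃ g : VecLp n ∞, (lpIncl _ le_top g : VecLp n 2) =
      modelProj Θ 2 (lpIncl _ le_top (trigVec k v)) := by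
  have h12 : (1 : ℝ≥0∞) < 2 := by norm_num
  have hc := isCompl_hardy (n := n) (q := 2) h12 le_rfl
  set e : VecLp n 2 := lpIncl _ le_top (trigVec k v) with he
  set w := Θ.mulAdjoint 2 e with hw
  set r : VecLp n ∞ := ∑ j ∈ Finset.range (k + 1), trigVec j (fourierCoeff w j) with hr
  have hrc : ∀ j : ℤ, fourierCoeff (lpIncl _ le_top r : VecLp n 2) j =
      ∑ i ∈ Finset.range (k + 1), if j = i then fourierCoeff w i else 0 := fun j => by
    rw [fourierCoeff_lpIncl, hr]
    induction Finset.range (k + 1) using Finset.induction_on with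
    | empty => simpa using fourierCoeff_zero' (p := ∞) j
    | insert a s ha ih =>
      rw [Finset.sum_insert ha, Finset.sum_insert ha, fourierCoeff_add', ih, fourierCoeff_trigVec]
  have hehardy : e ∈ hardy n 2 := fun j hj => by
    rw [he, fourierCoeff_lpIncl, fourierCoeff_trigVec, if_neg (by omega)]
  have hrhardy : (lpIncl _ le_top r : VecLp n 2) ∈ hardy n 2 := fun j hj => by
    rw [hrc]
    exact Finset.sum_eq_zero fun i _ => if_neg (by omega)
  -- $\Theta^*$ has no positive frequencies and $e$ has only the frequency $k$. Hence $P_+w$ is the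
  -- polynomial $r$ with frequencies $0,\dots,k$.
  have hwk : ∀ j : ℤ, k < j → fourierCoeff w j = 0 := fun j hj => by
    obtain ⟨S, hS⟩ := exists_isSpectralProjection_singleton (q := 2) k
    refine hS.fourierCoeff_mulLp_eq_zero h12 (by simp) Θ.memMatLp.conjTranspose
      (fun i l m hm => Θ.coeff_conjTranspose i l _ ?_) fun m hm => ?_
    · rw [Set.mem_singleton_iff.1 hm]; omega
    · rw [he, fourierCoeff_lpIncl, fourierCoeff_trigVec]
      exact if_neg hm
  have hwr : rieszPlus n 2 w = lpIncl _ le_top r := by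
    refine rieszPlus_eq hc hrhardy fun j hj => ?_
    rw [sub_eq_add_neg, fourierCoeff_add', ← neg_one_smul ℂ, fourierCoeff_smul', hrc]
    lift j to ℕ using hj
    simp only [Nat.cast_inj, Finset.sum_ite_eq, Finset.mem_range]
    split_ifs with h
    · simp
    · rw [hwk j (by omega)]; simp
  refine ⟨trigVec k v - Θ.mul ∞ r, ?_⟩
  have h3 : (lpIncl _ le_top (Θ.mul ∞ r) : VecLp n 2) = Θ.mul 2 (lpIncl _ le_top r) :=
    (mulLp_lpIncl le_top le_top Θ.memMatLp Θ.memMatLp r).symm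
  have h4 : modelProj Θ 2 e = rieszPlus n 2 (e - Θ.mul 2 (lpIncl _ le_top r)) := by
    change rieszPlus n 2 (Θ.mul 2 (w - rieszPlus n 2 w)) = _
    rw [hwr, map_sub (Θ.mul 2), hw, Θ.mul_mulAdjoint]
  rw [map_sub, h3, h4]
  refine (rieszPlus_eq hc (Submodule.sub_mem _ hehardy ?_)
    (by rw [sub_self]; exact zero_mem _)).symm
  exact mulLp_mem_hardy h12 le_rfl _ Θ.analytic hrhardy


lemma modelProj_trigVec_of_neg {n : ℕ} (Θ : InnerMatrix n) {k : ℤ} (hk : k < 0)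
    (v : EuclideanSpace ℂ (Fin n)) :
    modelProj Θ 2 (lpIncl _ le_top (trigVec k v)) = 0 := by
  rw [modelProj_two, Submodule.coe_orthogonalProjectionOnto_apply,
    Submodule.starProjection_apply_eq_zero_iff, Submodule.mem_orthogonal']
  refine fun u hu => inner_eq_zero_of_mem (fun j hj => ?_) hu.2
  rw [fourierCoeff_lpIncl, fourierCoeff_trigVec, if_neg (by omega)]

lemma clm_ext_trigVec {n : ℕ} {E : Type*} [NormedAddCommGroup E] [NormedSpace ℂ E]
    {L L' : VecLp n 2 →L[ℂ] E}
    (h : ∀ k v, L (lpIncl _ le_top (trigVec k v)) = L' (lpIncl _ le_top (trigVec k v))) :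
    L = L' := by
  have htop : (LinearMap.ker (L - L').toLinearMap) = ⊤ := by
    have hcl : IsClosed ((LinearMap.ker (L - L').toLinearMap : Submodule ℂ (VecLp n 2)) :
        Set (VecLp n 2)) := (L - L').isClosed_ker
    rw [← hcl.submodule_topologicalClosure_eq, Submodule.topologicalClosure_eq_top_iff,
      Submodule.eq_bot_iff]
    intro x hx
    have h0 : ∀ k, fourierCoeff x k = 0 := fun k => by
      -- Testing $x$ against its own $k$-th Fourier term gives $\|\hat x(k)\|^2=0$.
      have := (Submodule.mem_orthogonal _ _).1 hx (lpIncl _ le_top (trigVec k (fourierCoeff x k)))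
        (by simp [h])
      rwa [inner_trigVec, inner_self_eq_zero] at this
    have hc := isCompl_hardy (n := n) (q := 2) (by norm_num) le_rfl
    exact (Submodule.disjoint_def.1 hc.disjoint) x (fun k _ => h0 k) (fun k _ => h0 k)
  ext1 x
  have : x ∈ LinearMap.ker (L - L').toLinearMap := htop ▸ Submodule.mem_top
  exact sub_eq_zero.1 this

/-! ### Comparison of the two operators -/

lemma one_lt_of_holderTriple_two {p q : ℝ≥0∞} (hp : 2 < p) [h : ENNReal.HolderTriple p 2 q] :
    1 < q := by
  rw [← ENNReal.inv_lt_inv, inv_one, ← h.inv_add_inv_eq_inv, ← ENNReal.inv_two_add_inv_two]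
  exact ENNReal.add_lt_add_right (by simp) (ENNReal.inv_lt_inv.2 hp)

lemma le_two_of_holderTriple_two {p q : ℝ≥0∞} [h : ENNReal.HolderTriple p 2 q] : q ≤ 2 := by
  rw [← ENNReal.inv_le_inv, ← h.inv_add_inv_eq_inv]
  exact le_add_self

lemma continuous_modifiedMTTO {n : ℕ} (Θ : InnerMatrix n) {p q : ℝ≥0∞}
    [ENNReal.HolderTriple p 2 q] [Fact (1 ≤ q)] (hc : IsCompl (hardy n q) (conjHardyZero n q))
    {G : UnitAddCircle → Matrix (Fin n) (Fin n) ℂ} (hG : MemMatLp p G) :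
    Continuous (modifiedMTTO (q := q) Θ G hG) :=
  (continuous_modelProj Θ hc).comp ((continuous_mulLp hG).comp continuous_subtype_val)

/-- On bounded functions of the model space, the modified operator agrees with the truncated
Toeplitz operator. -/
lemma modifiedMTTO_eq_of_bounded {n : ℕ} {Θ : InnerMatrix n} {p q : ℝ≥0∞} (hp : 2 ≤ p)
    [ENNReal.HolderTriple p 2 q] [Fact (1 ≤ q)] (h1 : 1 < q) (h2 : q ≤ 2)
    {G : UnitAddCircle → Matrix (Fin n) (Fin n) ℂ} (hG : MemMatLp p G)
    {A : modelSpace Θ 2 →L[ℂ] modelSpace Θ 2} (hA : IsMTTO Θ G (hG.mono hp) A)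
    (f : modelSpace Θ 2) (g : VecLp n ∞) (hg : lpIncl _ le_top g = f.1) :
    modifiedMTTO (q := q) Θ G hG f = lpIncl _ h2 (A f).1 := by
  have hgH : g ∈ hardy n ∞ := fun k hk => by
    rw [← fourierCoeff_lpIncl (q := 2) le_top, hg]
    exact f.2.2 k hk
  have hfg : f.1 =ᵐ[circleMeasure] g := hg ▸ coeFn_lpIncl le_top g
  -- $Gg$ is formed in $L^2$ from $G\in L^2$ and $g\in L^\infty$; its image in $L^q$ is the product
  -- formed from $G\in L^p$ and $f\in L^2$.
  rw [hA f ⟨g, hgH⟩ hfg, ← modelProj_two, ← modelProj_lpIncl Θ h1 h2,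
    ← mulLp_lpIncl (q := 2) (q' := q) le_top h2 (hG.mono hp) hG, hg]
  rfl

/-- The modified operator agrees with the truncated Toeplitz operator. -/
lemma modifiedMTTO_eq {n : ℕ} {Θ : InnerMatrix n} {p q : ℝ≥0∞} (hp : 2 ≤ p)
    [ENNReal.HolderTriple p 2 q] [Fact (1 ≤ q)] (h1 : 1 < q) (h2 : q ≤ 2)
    {G : UnitAddCircle → Matrix (Fin n) (Fin n) ℂ} (hG : MemMatLp p G)
    {A : modelSpace Θ 2 →L[ℂ] modelSpace Θ 2} (hA : IsMTTO Θ G (hG.mono hp) A)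
    (f : modelSpace Θ 2) :
    modifiedMTTO (q := q) Θ G hG f = lpIncl _ h2 (A f).1 := by
  let B : modelSpace Θ 2 →L[ℂ] VecLp n q :=
    ⟨modifiedMTTO (q := q) Θ G hG, continuous_modifiedMTTO Θ (isCompl_hardy h1 h2) hG⟩
  let B' : modelSpace Θ 2 →L[ℂ] VecLp n q := lpIncl _ h2 ∘L (modelSpace Θ 2).subtypeL ∘L A
  -- Composing with $P_\Theta$ moves the comparison to all of $(L^2)^n$, where vector characters
  -- suffice; their projections are the bounded elements needed.
  have key : B ∘L (modelSpace Θ 2).orthogonalProjectionOnto =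
      B' ∘L (modelSpace Θ 2).orthogonalProjectionOnto := by
    refine clm_ext_trigVec fun k v => ?_
    obtain ⟨g, hg⟩ : ∃ g : VecLp n ∞, (lpIncl _ le_top g : VecLp n 2) =
        modelProj Θ 2 (lpIncl _ le_top (trigVec k v)) := by
      rcases lt_or_ge k 0 with hk | hk
      · exact ⟨0, by rw [map_zero, modelProj_trigVec_of_neg Θ hk]⟩
      · lift k to ℕ using hk
        exact exists_lpIncl_eq_modelProj_trigVec Θ k v
    exact modifiedMTTO_eq_of_bounded hp h1 h2 hG hA _ g (hg.trans (modelProj_two Θ _))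
  have := DFunLike.congr_fun key f.1
  simpa [B, B', Submodule.orthogonalProjectionOnto_mem_subspace_eq_self] using this

end MTTO

end

theorem mainTheorem7 {n : ℕ} (Θ : MTTO.InnerMatrix n) {p q : ℝ≥0∞} (hp : 2 < p)
    [ENNReal.HolderTriple p 2 q] [Fact (1 ≤ q)]
    (G : UnitAddCircle → Matrix (Fin n) (Fin n) ℂ) (hG : MTTO.MemMatLp p G)
    (A : MTTO.modelSpace Θ 2 →L[ℂ] MTTO.modelSpace Θ 2)
    (hA : MTTO.IsMTTO Θ G (hG.mono hp.le) A) :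
    -- the modified operator is well defined and bounded from `K_Θ^2` into `K_Θ^q`
    IsCompl (MTTO.hardy n q) (MTTO.conjHardyZero n q) ∧
    (∀ f, MTTO.modifiedMTTO (q := q) Θ G hG f ∈ MTTO.modelSpace Θ q) ∧
    Continuous (MTTO.modifiedMTTO (q := q) Θ G hG) ∧
    -- it agrees with the truncated Toeplitz operator
    (∀ f, MTTO.modifiedMTTO (q := q) Θ G hG f =ᵐ[MTTO.circleMeasure] (A f).1) ∧
    -- its image lies in `K_Θ^2`
    ∀ f, ∃ g ∈ MTTO.modelSpace Θ 2,
      MTTO.modifiedMTTO (q := q) Θ G hG f =ᵐ[MTTO.circleMeasure] g := by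
  have h1 : 1 < q := MTTO.one_lt_of_holderTriple_two hp
  have h2 : q ≤ 2 := MTTO.le_two_of_holderTriple_two (p := p)
  have hc := MTTO.isCompl_hardy (n := n) h1 h2
  have hae : ∀ f, MTTO.modifiedMTTO (q := q) Θ G hG f =ᵐ[MTTO.circleMeasure] (A f).1 := fun f => by
    rw [MTTO.modifiedMTTO_eq hp.le h1 h2 hG hA]
    exact MTTO.coeFn_lpIncl h2 _
  exact ⟨hc, fun f => MTTO.modelProj_mem Θ h1 h2 _, MTTO.continuous_modifiedMTTO Θ hc hG, hae,
    fun f => ⟨(A f).1, (A f).2, hae f⟩⟩
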